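/- Let $\mathcal S,\mathcal A$ be finite nonempty sets, $K=|\mathcal S||\mathcal A|$ and $\gamma\in[0,1)$. Consider an arbitrary MDP with state space $\mathcal S$, action space $\mathcal A$, initial distribution $p$, transition probabilities $P(\cdot|s,a)$ and rewards $r:\mathcal S\times\mathcal A\to[0,1]$. For a policy $\pi(a|s)$ put $U^\pi(p)=\mathbb E\big[\sum_{t\ge0}\gamma^t r(s_t,a_t)\big]$ with $s_0\sim p$, $a_t\sim\pi(\cdot|s_t)$, $s_{t+1}\sim P(\cdot|s_t,a_t)$, and $V^\pi(p)=(1-\gamma)U^\pi(p)$; let $U^*(p),V^*(p)$ be the maxima over all policies. The MDP is accessed only through a generative model: one call returns a sample of $p$, a sample of $P(\cdot|s,a)$, or the value $r(s,a)$, for a chosen pair $(s,a)$. Algorithm ($N\ge 1$ given). Let $\mathcal X=[0,1]^{\mathcal S}\times\Delta(\mathcal S\times\mathcal A)$ and $\eta=(1-\gamma)(KN)^{-1/2}$. Start at $x_1=(v_1,\mu_1)$ with $\mu_1$ uniform and $v_1\in[0,1]^{\mathcal S}$ arbitrary. For $n=1,\dots,N-1$, with $x_n=(v_n,\mu_n)$: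 draw $s_0\sim p$, $(s,a)\sim\mu_n$, $s'\sim P(\cdot|s,a)$ and, independently, $(\hat s,\hat a)$ uniform on $\mathcal S\times\mathcal A$, $\hat s'\sim P(\cdot|\hat s,\hat a)$; let $$g_n=\Big(e_{s_0}+\tfrac{1}{1-\gamma}(\gamma e_{s'}-e_s),\ \ K\big(\tfrac1{1-\gamma}-r(\hat s,\hat a)-\tfrac{1}{1-\gamma}(\gamma v_n(\hat s')-v_n(\hat s))\big)e_{(\hat s,\hat a)}\Big)$$ and $$x_{n+1}=\operatorname*{arg\,min}_{x\in\mathcal X}\ \langle g_n,x\rangle+\tfrac1\eta B(x\|x_n),\qquad B\big((v',\mu')\|(v,\mu)\big)=\tfrac1{2|\mathcal S|}\|v'-v\|_2^2+\mathrm{KL}(\mu'\|\mu).$$ Return the policy $\hat\pi_N(a|s)\propto\hat\mu_N(s,a)$, where $\hat\mu_N=\frac1N\sum_{n=1}^N\mu_n$. Theorem. There are absolute constants $C>0$ and $k\in\mathbb N$ such that, for all $\mathcal S,\mathcal A,\gamma,v_1$, all $\varepsilon>0$ and $\delta\in(0,1)$, and every MDP as above, with $$B_2=C\,\frac{K\max(1,\log\frac1\delta)}{(1-\gamma)^2\varepsilon^2}\,\log^k\!\Big(2+\frac{K}{(1-\gamma)\varepsilon}\Big),\qquad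 B_4=C\,\frac{K\max(1,\log\frac1\delta)}{(1-\gamma)^4\varepsilon^2}\,\log^k\!\Big(2+\frac{K}{(1-\gamma)^2\varepsilon}\Big):$$ (i) for every integer $N\ge B_2$, $V^*(p)-V^{\hat\pi_N}(p)\le\varepsilon$ with probability at least $1-\delta$, and for $N=\lceil B_2\rceil$ the algorithm always makes at most $4B_2$ calls to the generative model; (ii) for every integer $N\ge B_4$, $U^*(p)-U^{\hat\pi_N}(p)\le\varepsilon$ with probability at least $1-\delta$, and for $N=\lceil B_4\rceil$ the algorithm always makes at most $4B_4$ calls to the generative model. -/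

import Mathlib

namespace MirrorRL

noncomputable section

universe u v w

/-! ### Tabular Markov decision processes -/

/-- A tabular MDP without its discount factor: the initial distribution, the transition
probabilities, and a reward function with values in `[0, 1]`. -/
structure MDP (S : Type u) (A : Type v) where
  init : PMF S
  trans : S → A → PMF S
  reward : S → A → ℝ
  reward_mem : ∀ s a, reward s a ∈ Set.Icc (0 : ℝ) 1

/-- A (randomized, stationary) policy `π(a|s)`. -/
abbrev Policy (S : Type u) (A : Type v) : Type (max u v) := S → PMF A

/-- The law of the state at time `t` when `π` is run from the state `s`. -/
def stateLaw {S : Type u} {A : Type v} (M : MDP S A) (π : Policy S A) (s : S) : ℕ → PMF S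
  | 0 => PMF.pure s
  | t + 1 => (stateLaw M π s t).bind fun x => (π x).bind fun a => M.trans x a

/-- The expected reward `E[r(s_t, a_t)]` at time `t` when `π` is run from the state `s`. -/
def expectedReward {S : Type u} {A : Type v} [Fintype S] [Fintype A]
    (M : MDP S A) (π : Policy S A) (s : S) (t : ℕ) : ℝ :=
  ∑ x, (stateLaw M π s t x).toReal * ∑ a, (π x a).toReal * M.reward x a

/-- The conventional expected discounted sum of rewards from `s`; the series converges
absolutely for `0 ≤ γ < 1`, since rewards are in `[0, 1]`. -/
def discountedValue {S : Type u} {A : Type v} [Fintype S] [Fintype A]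
    (γ : ℝ) (M : MDP S A) (π : Policy S A) (s : S) : ℝ :=
  ∑' t : ℕ, γ ^ t * expectedReward M π s t

/-- The normalized value function `V^π(s) = (1 - γ) E[∑ γ^t r(s_t, a_t)]`. -/
def value {S : Type u} {A : Type v} [Fintype S] [Fintype A]
    (γ : ℝ) (M : MDP S A) (π : Policy S A) (s : S) : ℝ :=
  (1 - γ) * discountedValue γ M π s

/-- `E_{s ∼ p}[f(s)]` for the initial distribution `p`. -/
def initMean {S : Type u} {A : Type v} [Fintype S] (M : MDP S A) (f : S → ℝ) : ℝ :=
  ∑ s, (M.init s).toReal * f s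

/-- `π` is `ε`-optimal for the normalized return: `V^*(p) - V^π(p) ≤ ε`. -/
def IsEpsOptimal {S : Type u} {A : Type v} [Fintype S] [Fintype A]
    (γ : ℝ) (M : MDP S A) (ε : ℝ) (π : Policy S A) : Prop :=
  ∀ π' : Policy S A, initMean M (value γ M π') - initMean M (value γ M π) ≤ ε

/-- `π` is `ε`-optimal for the conventional (unnormalized) discounted return. -/
def IsEpsOptimalUnnormalized {S : Type u} {A : Type v} [Fintype S] [Fintype A]
    (γ : ℝ) (M : MDP S A) (ε : ℝ) (π : Policy S A) : Prop :=
  ∀ π' : Policy S A,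
    initMean M (discountedValue γ M π') - initMean M (discountedValue γ M π) ≤ ε

/-! ### Randomized programs with access to a generative model -/

/-- A randomized program that sees the MDP only through a generative model: it may draw an
initial state, draw a successor of a chosen state-action pair, or read the reward of a chosen
state-action pair.  `coin q` is internal randomness: a draw from a distribution `q` that the
program itself has computed. -/
inductive GenProg (S : Type u) (A : Type v) (α : Type w) : Type (max u v w) where
  | done (x : α) : GenProg S A α
  | coin (q : PMF (S × A)) (next : S × A → GenProg S A α) : GenProg S A α
  | sampleInit (next : S → GenProg S A α) : GenProg S A α
  | sampleTrans (i : S × A) (next : S → GenProg S A α) : GenProg S A α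
  | queryReward (i : S × A) (next : ℝ → GenProg S A α) : GenProg S A α

/-- The joint law of the output of a program and of the number of calls that it makes to the
generative model of `M`. -/
def GenProg.exec {S : Type u} {A : Type v} {α : Type w} (M : MDP S A) :
    GenProg S A α → PMF (α × ℕ)
  | .done x => PMF.pure (x, 0)
  | .coin q next => q.bind fun i => (next i).exec M
  | .sampleInit next =>
      M.init.bind fun s => ((next s).exec M).map fun o => (o.1, o.2 + 1)
  | .sampleTrans i next =>
      (M.trans i.1 i.2).bind fun s => ((next s).exec M).map fun o => (o.1, o.2 + 1)
  | .queryReward i next =>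
      ((next (M.reward i.1 i.2)).exec M).map fun o => (o.1, o.2 + 1)

/-! ### Stochastic mirror descent -/

/-- Pairs `(v, μ)` of a function on states and a function on state-action pairs. -/
abbrev Vec (S : Type u) (A : Type v) : Type (max u v) := (S → ℝ) × (S × A → ℝ)

/-- The decision set: `v` in the unit cube and `μ` in the probability simplex. -/
def decisionSet (S : Type u) (A : Type v) [Fintype S] [Fintype A] : Set (Vec S A) :=
  {v | ∀ s, 0 ≤ v s ∧ v s ≤ 1} ×ˢ stdSimplex ℝ (S × A)

/-- An element of the decision set. -/
abbrev Decision (S : Type u) (A : Type v) [Fintype S] [Fintype A] : Type (max u v) :=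
  {x : Vec S A // x ∈ decisionSet S A}

/-- The Bregman divergence `B_R(x' ‖ x) = ‖v' - v‖₂² / (2|S|) + KL(μ' ‖ μ)`.  It is used only
for `μ` with positive entries. -/
def bregman {S : Type u} {A : Type v} [Fintype S] [Fintype A] (x' x : Vec S A) : ℝ :=
  1 / (2 * (Fintype.card S : ℝ)) * ∑ s, (x'.1 s - x.1 s) ^ 2
    + ∑ i, x'.2 i * Real.log (x'.2 i / x.2 i)

/-- The objective `⟨g, y⟩ + B_R(y ‖ x) / η` of a mirror descent step from `x`. -/
def mdObjective {S : Type u} {A : Type v} [Fintype S] [Fintype A]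
    (η : ℝ) (g x y : Vec S A) : ℝ :=
  (∑ s, g.1 s * y.1 s + ∑ i, g.2 i * y.2 i) + 1 / η * bregman y x

theorem decisionSet_isCompact (S : Type u) (A : Type v) [Fintype S] [Fintype A] :
    IsCompact (decisionSet S A) := by
  refine IsCompact.prod ?_ (isCompact_stdSimplex ℝ (S × A))
  have h : {v : S → ℝ | ∀ s, 0 ≤ v s ∧ v s ≤ 1} = Set.univ.pi fun _ => Set.Icc (0 : ℝ) 1 := by
    ext v
    simp only [Set.mem_ofPred_eq, Set.mem_pi, Set.mem_univ, true_implies, Set.mem_Icc]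
  rw [h]
  exact isCompact_univ_pi fun _ => isCompact_Icc

theorem mdObjective_continuous {S : Type u} {A : Type v} [Fintype S] [Fintype A]
    (η : ℝ) (g x : Vec S A) : Continuous (mdObjective η g x) := by
  have key : ∀ c : ℝ, Continuous fun t : ℝ => t * Real.log (t / c) := by
    intro c
    by_cases hc : c = 0
    · simpa [hc] using continuous_const
    · have h : (fun t : ℝ => t * Real.log (t / c)) =
          fun t : ℝ => c * ((t / c) * Real.log (t / c)) := by
        funext t
        field_simp
      rw [h]
      exact continuous_const.mul
        (Real.continuous_mul_log.comp (continuous_id.div_const c))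
  unfold mdObjective bregman
  have h2 : ∀ i : S × A, Continuous fun y : Vec S A => y.2 i * Real.log (y.2 i / x.2 i) :=
    fun i => (key (x.2 i)).comp ((continuous_apply i).comp continuous_snd)
  have h3 : Continuous fun y : Vec S A => ∑ i, y.2 i * Real.log (y.2 i / x.2 i) :=
    continuous_finsetSum _ fun i _ => h2 i
  fun_prop

theorem exists_mdStep {S : Type u} {A : Type v} [Fintype S] [Fintype A]
    (η : ℝ) (g : Vec S A) (x : Decision S A) :
    ∃ y : Decision S A, ∀ z : Decision S A,
      mdObjective η g x.1 y.1 ≤ mdObjective η g x.1 z.1 := by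
  obtain ⟨y, hy, hmin⟩ := (decisionSet_isCompact S A).exists_isMinOn ⟨x.1, x.2⟩
    (mdObjective_continuous η g x.1).continuousOn
  exact ⟨⟨y, hy⟩, fun z => hmin z.2⟩

/-- The mirror descent update `argmin_{y} ⟨g, y⟩ + B_R(y ‖ x) / η` over the decision set. -/
def mdStep {S : Type u} {A : Type v} [Fintype S] [Fintype A]
    (η : ℝ) (g : Vec S A) (x : Decision S A) : Decision S A :=
  (exists_mdStep η g x).choose

/-- The `μ`-component of a decision, as a distribution on state-action pairs. -/
def flowPMF {S : Type u} {A : Type v} [Fintype S] [Fintype A] (x : Decision S A) :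
    PMF (S × A) :=
  PMF.ofFintype (fun i => ENNReal.ofReal (x.1.2 i)) (by
    obtain ⟨h0, h1⟩ := x.2.2
    rw [← ENNReal.ofReal_sum_of_nonneg fun i _ => h0 i, h1, ENNReal.ofReal_one])

/-- The policy `π_μ(a|s) ∝ μ(s, a)` (uniform at the states where `μ(s, ·) = 0`). -/
def flowPolicy {S : Type u} {A : Type v} [Fintype A] [Nonempty A]
    (μ : S × A → ℝ) : Policy S A :=
  open Classical in
  fun s =>
    if h : ∑' a, ENNReal.ofReal (μ (s, a)) ≠ 0 then
      PMF.normalize (fun a => ENNReal.ofReal (μ (s, a))) h (by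
        rw [tsum_fintype]
        exact ENNReal.sum_ne_top.2 fun a _ => ENNReal.ofReal_ne_top)
    else PMF.uniformOfFintype A

/-- The initial decision `x₁ = (v₁, μ₁)` with `μ₁` uniform. -/
def initialDecision {S : Type u} {A : Type v} [Fintype S] [Fintype A] [Nonempty S] [Nonempty A]
    (v₁ : S → ℝ) (hv₁ : ∀ s, 0 ≤ v₁ s ∧ v₁ s ≤ 1) : Decision S A :=
  ⟨(v₁, fun _ => 1 / (Fintype.card (S × A) : ℝ)), hv₁, fun _ => by positivity, by
    simp [Finset.sum_const, -Fintype.card_prod]⟩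

/-- The sampled gradient at `x = (v, μ)`.  Its `v`-part is built from an initial state `s₀`, a
state-action pair `i` drawn from `μ`, and a successor `s'` of `i`.  Its `μ`-part is supported at
a uniformly drawn state-action pair `j`, and uses the reward `r` and a successor `t'` of `j`. -/
def sampledGradient {S : Type u} {A : Type v} [Fintype S] [Fintype A]
    (γ : ℝ) (x : Vec S A) (s₀ : S) (i : S × A) (s' : S) (j : S × A) (r : ℝ) (t' : S) : Vec S A :=
  open Classical in
  (Pi.single s₀ 1 + (1 / (1 - γ)) • (γ • Pi.single s' 1 - Pi.single i.1 1),
    (Fintype.card (S × A) : ℝ) •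
      Pi.single j (1 / (1 - γ) - r - 1 / (1 - γ) * (γ * x.1 t' - x.1 j.1)))

/-- `mdLoop γ η N m x acc` performs `m` further rounds of stochastic mirror descent from the
current decision `x`, where `acc` is the sum of the earlier decisions, and returns the policy
of the average of the `N` decisions. -/
def mdLoop {S : Type u} {A : Type v} [Fintype S] [Fintype A] [Nonempty S] [Nonempty A]
    (γ η : ℝ) (N : ℕ) : ℕ → Decision S A → Vec S A → GenProg S A (Policy S A)
  | 0, x, acc => .done (flowPolicy ((1 / (N : ℝ)) • (acc + x.1)).2)
  | m + 1, x, acc =>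
      .sampleInit fun s₀ =>
      .coin (flowPMF x) fun i =>
      .sampleTrans i fun s' =>
      .coin (PMF.uniformOfFintype (S × A)) fun j =>
      .queryReward j fun r =>
      .sampleTrans j fun t' =>
      mdLoop γ η N m (mdStep η (sampledGradient γ x.1 s₀ i s' j r t') x) (acc + x.1)

/-- Mirror descent for RL with `N` decisions `x₁, …, x_N` (hence `N - 1` rounds), step size
`η = (1 - γ) (|S||A|N)^{-1/2}` and initial decision `x₁ = (v₁, uniform)`. -/
def mirrorDescentRL {S : Type u} {A : Type v} [Fintype S] [Fintype A] [Nonempty S] [Nonempty A]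
    (γ : ℝ) (v₁ : S → ℝ) (hv₁ : ∀ s, 0 ≤ v₁ s ∧ v₁ s ≤ 1) (N : ℕ) :
    GenProg S A (Policy S A) :=
  mdLoop γ ((1 - γ) / √((Fintype.card S : ℝ) * (Fintype.card A : ℝ) * (N : ℝ))) N (N - 1)
    (initialDecision v₁ hv₁) 0

/-- The bound `C |S||A| log(1/δ) / ((1 - γ)² ε²)` times the logarithmic factor
`log(2 + |S||A| / ((1 - γ) ε))^k`; here `log(1/δ)` is read as `max(1, log(1/δ))`. -/
def normalizedRate (C : ℝ) (k : ℕ) (S : Type u) (A : Type v) [Fintype S] [Fintype A]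
    (γ ε δ : ℝ) : ℝ :=
  C * ((Fintype.card S : ℝ) * (Fintype.card A : ℝ) * max 1 (Real.log (1 / δ))
      / ((1 - γ) ^ 2 * ε ^ 2))
    * Real.log (2 + (Fintype.card S : ℝ) * (Fintype.card A : ℝ) / ((1 - γ) * ε)) ^ k

/-- The bound `C |S||A| log(1/δ) / ((1 - γ)⁴ ε²)` times the logarithmic factor
`log(2 + |S||A| / ((1 - γ)² ε))^k`; here `log(1/δ)` is read as `max(1, log(1/δ))`. -/
def unnormalizedRate (C : ℝ) (k : ℕ) (S : Type u) (A : Type v) [Fintype S] [Fintype A]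
    (γ ε δ : ℝ) : ℝ :=
  C * ((Fintype.card S : ℝ) * (Fintype.card A : ℝ) * max 1 (Real.log (1 / δ))
      / ((1 - γ) ^ 4 * ε ^ 2))
    * Real.log (2 + (Fintype.card S : ℝ) * (Fintype.card A : ℝ) / ((1 - γ) ^ 2 * ε)) ^ k

end

end MirrorRL

/-! Write H = 1/(1-γ) and Λ(v, μ) = E_p[v] + ⟨μ, advantage of v⟩. The sampled gradient is unbiased
for the v-derivative of Λ and for minus its μ-derivative plus the constant H, so the algorithm is
stochastic mirror descent for the game in which v minimizes and μ maximizes Λ. Two facts turn regret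
into suboptimality. If ν is the occupancy measure of a policy of value J, then Λ(v, ν) = J for every
v (`exists_occupancy`). If q is the value of the policy π read off the average flow, then the
advantage of q has mean zero under that flow (`sum_mul_advantage_flowPolicy`). Hence N(J - V^π(p))
is exactly the sum of Λ(v_n, ν) - Λ(q, μ_n), the regret against the comparator (q, ν). The
difficulty is that q depends on all the samples, so the gradient noise paired with v_n - q is not a
martingale difference. A ghost sequence u_n does projected gradient descent on the noise itself. Its
regret bound holds for every q at once, and what remains is the noise paired with v_n - u_n, where
u_n is determined by the past (`regret_round_le`). The μ-gradient carries a factor K from importance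
weighting, but its coordinate is uniform, so its second moment in the local norm has order K H² and
not K² H² (`mean_exp_roundIncrement_le`). A Chernoff bound, proved by induction along the program
(`exec_mdLoop_tail`), then gives regret of order H √(KN log(1/δ)) up to a factor log K. Dividing by
N gives the normalized rate; the unnormalized one is the same statement at accuracy (1-γ)ε. -/

namespace MirrorRL

noncomputable section

/-! ### Expectations over finite types -/

/-- The expectation of `f` under the distribution `p` on a finite type. -/
def mean {α : Type*} [Fintype α] (p : PMF α) (f : α → ℝ) : ℝ := ∑ x, (p x).toReal * f x

section Mean

variable {α β : Type*} [Fintype α] [Fintype β] (p : PMF α)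

theorem sum_toReal_eq_one : ∑ x, (p x).toReal = 1 := by
  rw [← ENNReal.toReal_sum fun x _ => p.apply_ne_top x, ← tsum_fintype (L := .unconditional α),
    p.tsum_coe, ENNReal.toReal_one]

theorem mean_const (c : ℝ) : mean p (fun _ => c) = c := by
  rw [mean, ← Finset.sum_mul, sum_toReal_eq_one, one_mul]

theorem mean_add (f g : α → ℝ) : mean p (fun x => f x + g x) = mean p f + mean p g := by
  simp only [mean, mul_add, Finset.sum_add_distrib]

theorem mean_sub (f g : α → ℝ) : mean p (fun x => f x - g x) = mean p f - mean p g := by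
  simp only [mean, mul_sub, Finset.sum_sub_distrib]

theorem mean_const_mul (c : ℝ) (f : α → ℝ) : mean p (fun x => c * f x) = c * mean p f := by
  simp only [mean, Finset.mul_sum]
  exact Finset.sum_congr rfl fun x _ => by ring

theorem mean_mono {f g : α → ℝ} (h : ∀ x, f x ≤ g x) : mean p f ≤ mean p g :=
  Finset.sum_le_sum fun x _ => mul_le_mul_of_nonneg_left (h x) ENNReal.toReal_nonneg

theorem mean_nonneg {f : α → ℝ} (h : ∀ x, 0 ≤ f x) : 0 ≤ mean p f :=
  Finset.sum_nonneg fun x _ => mul_nonneg ENNReal.toReal_nonneg (h x)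

theorem mean_mem_Icc {f : α → ℝ} {a b : ℝ} (h : ∀ x, f x ∈ Set.Icc a b) :
    mean p f ∈ Set.Icc a b :=
  ⟨(mean_const p a).symm.trans_le (mean_mono p fun x => (h x).1),
    (mean_mono p fun x => (h x).2).trans_eq (mean_const p b)⟩

theorem mean_pure (a : α) (f : α → ℝ) : mean (PMF.pure a) f = f a := by
  classical
  rw [mean, Finset.sum_eq_single a]
  · simp
  · intro b _ hb
    simp [hb]
  · simp

omit [Fintype β] in
theorem toReal_bind_apply (q : α → PMF β) (b : β) :
    (p.bind q b).toReal = mean p fun x => (q x b).toReal := by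
  rw [PMF.bind_apply, tsum_fintype, ENNReal.toReal_sum]
  · simp [mean, ENNReal.toReal_mul]
  · exact fun x _ => ENNReal.mul_ne_top (p.apply_ne_top x) ((q x).apply_ne_top b)

theorem mean_bind (q : α → PMF β) (f : β → ℝ) :
    mean (p.bind q) f = mean p fun x => mean (q x) f := by
  rw [mean]
  simp only [toReal_bind_apply]
  simp only [mean, Finset.sum_mul, Finset.mul_sum]
  rw [Finset.sum_comm]
  exact Finset.sum_congr rfl fun x _ => Finset.sum_congr rfl fun y _ => by ring

/-- Expectations commute with finite sums. -/
theorem mean_sum {ι : Type*} (s : Finset ι) (f : ι → α → ℝ) :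
    mean p (fun x => ∑ i ∈ s, f i x) = ∑ i ∈ s, mean p (f i) := by
  simp only [mean, Finset.mul_sum]
  exact Finset.sum_comm

theorem mean_uniform [Nonempty α] (f : α → ℝ) :
    mean (PMF.uniformOfFintype α) f = 1 / (Fintype.card α : ℝ) * ∑ x, f x := by
  simp [mean, Finset.mul_sum]

end Mean

/-! ### Value functions and occupancy measures -/

section Value

variable {S A : Type*} [Fintype S] [Fintype A] {γ : ℝ} (M : MDP S A) (π : Policy S A)

/-- The law of the next state when `π` is run for one step from `x`. -/
def policyStep (x : S) : PMF S := (π x).bind fun a => M.trans x a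

-- `stateLaw` appends steps at the end, whereas the Bellman equation needs the first step split off.
omit [Fintype S] [Fintype A] in
theorem stateLaw_succ_eq_bind (s : S) (t : ℕ) :
    stateLaw M π s (t + 1) = (policyStep M π s).bind fun y => stateLaw M π y t := by
  induction t with
  | zero =>
    simp only [stateLaw, PMF.pure_bind, policyStep]
    exact (PMF.bind_pure _).symm
  | succ t ih =>
    rw [stateLaw, ih, PMF.bind_bind]
    rfl

theorem expectedReward_eq_mean (s : S) (t : ℕ) :
    expectedReward M π s t = mean (stateLaw M π s t) fun x => mean (π x) (M.reward x) := rfl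

theorem expectedReward_mem (s : S) (t : ℕ) : expectedReward M π s t ∈ Set.Icc (0 : ℝ) 1 :=
  mean_mem_Icc _ fun x => mean_mem_Icc _ fun a => M.reward_mem x a

theorem expectedReward_zero (s : S) : expectedReward M π s 0 = mean (π s) (M.reward s) := by
  rw [expectedReward_eq_mean, stateLaw, mean_pure]

theorem expectedReward_succ (s : S) (t : ℕ) :
    expectedReward M π s (t + 1) = mean (policyStep M π s) fun y => expectedReward M π y t := by
  rw [expectedReward_eq_mean, stateLaw_succ_eq_bind, mean_bind]
  rfl

theorem summable_geometric_mul_of_bounded (h0 : 0 ≤ γ) (h1 : γ < 1) {f : ℕ → ℝ} {b : ℝ}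
    (hf : ∀ t, |f t| ≤ b) : Summable fun t => γ ^ t * f t := by
  refine Summable.of_norm_bounded ((summable_geometric_of_lt_one h0 h1).mul_right b) fun t => ?_
  rw [Real.norm_eq_abs, abs_mul, abs_of_nonneg (pow_nonneg h0 t)]
  exact mul_le_mul_of_nonneg_left (hf t) (pow_nonneg h0 t)

theorem summable_expectedReward (h0 : 0 ≤ γ) (h1 : γ < 1) (s : S) :
    Summable fun t => γ ^ t * expectedReward M π s t :=
  summable_geometric_mul_of_bounded h0 h1 (b := 1) fun t => by
    obtain ⟨h, h'⟩ := expectedReward_mem M π s t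
    rwa [abs_of_nonneg h]

theorem mean_tsum {α : Type*} [Fintype α] (p : PMF α) {f : α → ℕ → ℝ}
    (hf : ∀ x, Summable (f x)) : mean p (fun x => ∑' t, f x t) = ∑' t, mean p fun x => f x t := by
  simp only [mean]
  rw [Summable.tsum_finsetSum fun x _ => (hf x).mul_left _]
  exact Finset.sum_congr rfl fun x _ => tsum_mul_left.symm

theorem discountedValue_bellman (h0 : 0 ≤ γ) (h1 : γ < 1) (s : S) :
    discountedValue γ M π s =
      mean (π s) (M.reward s) + γ * mean (policyStep M π s) (discountedValue γ M π) := by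
  have e : mean (policyStep M π s) (discountedValue γ M π) =
      ∑' t, mean (policyStep M π s) fun y => γ ^ t * expectedReward M π y t :=
    mean_tsum _ fun x => summable_expectedReward M π h0 h1 x
  rw [e, ← tsum_mul_left, discountedValue, (summable_expectedReward M π h0 h1 s).tsum_eq_zero_add,
    pow_zero, one_mul, expectedReward_zero]
  congr 1
  refine tsum_congr fun t => ?_
  rw [expectedReward_succ, mean_const_mul, pow_succ]
  ring

theorem value_mem (h0 : 0 ≤ γ) (h1 : γ < 1) (s : S) : value γ M π s ∈ Set.Icc (0 : ℝ) 1 := by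
  have hpos : 0 < 1 - γ := sub_pos.2 h1
  have hle : discountedValue γ M π s ≤ (1 - γ)⁻¹ := by
    rw [← tsum_geometric_of_lt_one h0 h1]
    refine (summable_expectedReward M π h0 h1 s).tsum_le_tsum (fun t => ?_)
      (summable_geometric_of_lt_one h0 h1)
    exact mul_le_of_le_one_right (pow_nonneg h0 t) (expectedReward_mem M π s t).2
  have hge : 0 ≤ discountedValue γ M π s :=
    tsum_nonneg fun t => mul_nonneg (pow_nonneg h0 t) (expectedReward_mem M π s t).1
  refine ⟨mul_nonneg hpos.le hge, ?_⟩
  calc (1 - γ) * discountedValue γ M π s ≤ (1 - γ) * (1 - γ)⁻¹ := by gcongr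
    _ = 1 := mul_inv_cancel₀ hpos.ne'

/-- The normalized advantage `r + (γ P v - v) / (1 - γ)` of a function `v` on states. -/
def advantage (γ : ℝ) (M : MDP S A) (v : S → ℝ) (i : S × A) : ℝ :=
  M.reward i.1 i.2 + 1 / (1 - γ) * (γ * mean (M.trans i.1 i.2) v - v i.1)

theorem mean_advantage (v : S → ℝ) (s : S) :
    mean (π s) (fun a => advantage γ M v (s, a)) =
      mean (π s) (M.reward s) + 1 / (1 - γ) * (γ * mean (policyStep M π s) v - v s) := by
  simp only [advantage]
  rw [mean_add, mean_const_mul, mean_sub, mean_const_mul, mean_const, policyStep, mean_bind]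

theorem mean_advantage_value (h0 : 0 ≤ γ) (h1 : γ < 1) (s : S) :
    mean (π s) (fun a => advantage γ M (value γ M π) (s, a)) = 0 := by
  have hpos : 1 - γ ≠ 0 := (sub_pos.2 h1).ne'
  have e : mean (policyStep M π s) (value γ M π) =
      (1 - γ) * mean (policyStep M π s) (discountedValue γ M π) := mean_const_mul _ _ _
  rw [mean_advantage, e, value, discountedValue_bellman M π h0 h1 s]
  field_simp
  ring

omit [Fintype S] in
theorem flowPolicy_sum_mul [Nonempty A] {μ : S × A → ℝ} (hμ : ∀ i, 0 ≤ μ i) (s : S) (a : A) :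
    (∑ b, μ (s, b)) * (flowPolicy μ s a).toReal = μ (s, a) := by
  classical
  have hsum : ∑' b, ENNReal.ofReal (μ (s, b)) = ENNReal.ofReal (∑ b, μ (s, b)) := by
    rw [tsum_fintype, ENNReal.ofReal_sum_of_nonneg fun b _ => hμ _]
  have h0 : 0 ≤ ∑ b, μ (s, b) := Finset.sum_nonneg fun b _ => hμ _
  by_cases h : ∑' b, ENNReal.ofReal (μ (s, b)) ≠ 0
  · have hne : ∑ b, μ (s, b) ≠ 0 := by
      rintro h'
      exact h (by rw [hsum, h', ENNReal.ofReal_zero])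
    rw [flowPolicy, dif_pos h, PMF.normalize_apply, hsum, ENNReal.toReal_mul, ENNReal.toReal_inv,
      ENNReal.toReal_ofReal (hμ _), ENNReal.toReal_ofReal h0]
    field_simp
  · have hz : ∑ b, μ (s, b) = 0 := by
      rw [not_not, hsum, ENNReal.ofReal_eq_zero] at h
      exact le_antisymm h h0
    have := (Finset.sum_eq_zero_iff_of_nonneg fun b _ => hμ (s, b)).1 hz a (Finset.mem_univ a)
    rw [hz, zero_mul, this]

/-- At each state μ(s, ·) is a multiple of the policy, under which its own advantage averages to
zero. A state without mass has multiple zero, so the default policy there is irrelevant. No flow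
constraint on μ is needed. -/
theorem sum_mul_advantage_flowPolicy [Nonempty A] (h0 : 0 ≤ γ) (h1 : γ < 1) {μ : S × A → ℝ}
    (hμ : ∀ i, 0 ≤ μ i) :
    ∑ i, μ i * advantage γ M (value γ M (flowPolicy μ)) i = 0 := by
  rw [Fintype.sum_prod_type]
  refine Finset.sum_eq_zero fun s _ => ?_
  have h := mean_advantage_value M (flowPolicy μ) h0 h1 s
  calc ∑ a, μ (s, a) * advantage γ M (value γ M (flowPolicy μ)) (s, a)
      = (∑ b, μ (s, b)) * mean (flowPolicy μ s)
          fun a => advantage γ M (value γ M (flowPolicy μ)) (s, a) := by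
        rw [mean, Finset.mul_sum]
        refine Finset.sum_congr rfl fun a _ => ?_
        rw [← mul_assoc, flowPolicy_sum_mul hμ]
    _ = 0 := by rw [h, mul_zero]

/-- The law of the state at time `t` when `π` is run from the initial distribution. -/
def initLaw (t : ℕ) : PMF S := M.init.bind fun s => stateLaw M π s t

omit [Fintype S] [Fintype A] in
theorem initLaw_zero : initLaw M π 0 = M.init := PMF.bind_pure _

omit [Fintype S] [Fintype A] in
theorem initLaw_succ (t : ℕ) : initLaw M π (t + 1) = (initLaw M π t).bind (policyStep M π) := by
  rw [initLaw, initLaw, PMF.bind_bind]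
  rfl

/-- The normalized discounted state occupancy of `π`. -/
def stateOccupancy (γ : ℝ) (s : S) : ℝ := (1 - γ) * ∑' t, γ ^ t * (initLaw M π t s).toReal

theorem abs_mean_le {α : Type*} [Fintype α] (p : PMF α) {f : α → ℝ} {b : ℝ}
    (h : ∀ x, |f x| ≤ b) : |mean p f| ≤ b :=
  abs_le.2 (mean_mem_Icc p fun x => abs_le.1 (h x))

theorem exists_abs_le {α : Type*} [Finite α] (f : α → ℝ) : ∃ b, ∀ x, |f x| ≤ b := by
  obtain ⟨b, hb⟩ := (Set.finite_range fun x => |f x|).bddAbove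
  exact ⟨b, fun x => hb ⟨x, rfl⟩⟩

omit [Fintype A] in
theorem summable_mean_initLaw (h0 : 0 ≤ γ) (h1 : γ < 1) (f : S → ℝ) :
    Summable fun t => γ ^ t * mean (initLaw M π t) f := by
  obtain ⟨b, hb⟩ := exists_abs_le f
  exact summable_geometric_mul_of_bounded h0 h1 fun t => abs_mean_le _ hb

omit [Fintype A] in
theorem sum_stateOccupancy_mul (h0 : 0 ≤ γ) (h1 : γ < 1) (f : S → ℝ) :
    ∑ s, stateOccupancy M π γ s * f s = (1 - γ) * ∑' t, γ ^ t * mean (initLaw M π t) f := by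
  have hs : ∀ s : S, Summable fun t => γ ^ t * (initLaw M π t s).toReal := fun s =>
    summable_geometric_mul_of_bounded h0 h1 (b := 1) fun t => by
      rw [abs_of_nonneg ENNReal.toReal_nonneg]
      exact ENNReal.toReal_le_of_le_ofReal zero_le_one (by simpa using PMF.coe_le_one _ s)
  have e : ∀ t, γ ^ t * mean (initLaw M π t) f =
      ∑ s, γ ^ t * (initLaw M π t s).toReal * f s := fun t => by
    rw [mean, Finset.mul_sum]
    exact Finset.sum_congr rfl fun s _ => by ring
  simp only [e, stateOccupancy]
  rw [Summable.tsum_finsetSum fun s _ => (hs s).mul_right _, Finset.mul_sum]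
  exact Finset.sum_congr rfl fun s _ => by rw [tsum_mul_right, mul_assoc]

-- The discounted sum over time telescopes, and only the term at time zero, the initial
-- distribution, survives.
omit [Fintype A] in
theorem stateOccupancy_flow (h0 : 0 ≤ γ) (h1 : γ < 1) (v : S → ℝ) :
    ∑ s, stateOccupancy M π γ s * (γ * mean (policyStep M π s) v - v s) =
      -((1 - γ) * initMean M v) := by
  have hsum := summable_mean_initLaw M π h0 h1 v
  have e : ∀ t, γ ^ t * mean (initLaw M π t) (fun s => γ * mean (policyStep M π s) v - v s) =
      γ ^ (t + 1) * mean (initLaw M π (t + 1)) v - γ ^ t * mean (initLaw M π t) v := fun t => by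
    rw [mean_sub, mean_const_mul, initLaw_succ, mean_bind]
    ring
  rw [sum_stateOccupancy_mul M π h0 h1]
  simp only [e]
  have hsum' := (summable_nat_add_iff 1).2 hsum
  rw [hsum'.tsum_sub hsum, hsum.tsum_eq_zero_add, pow_zero, one_mul, initLaw_zero]
  simp only [mean, initMean]
  ring

theorem initMean_value_eq (h0 : 0 ≤ γ) (h1 : γ < 1) :
    initMean M (value γ M π) =
      ∑ s, stateOccupancy M π γ s * mean (π s) (M.reward s) := by
  rw [sum_stateOccupancy_mul M π h0 h1]
  change mean M.init (fun s => (1 - γ) * discountedValue γ M π s) = _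
  rw [mean_const_mul]
  congr 1
  refine (mean_tsum M.init fun x => summable_expectedReward M π h0 h1 x).trans ?_
  refine tsum_congr fun t => ?_
  rw [mean_const_mul, initLaw, mean_bind]
  rfl

/-- Every policy has an occupancy measure, which represents the difference between its value
and any function on states. -/
theorem exists_occupancy (h0 : 0 ≤ γ) (h1 : γ < 1) :
    ∃ μ ∈ stdSimplex ℝ (S × A), ∀ v : S → ℝ,
      ∑ i, μ i * advantage γ M v i = initMean M (value γ M π) - initMean M v := by
  have hpos : 0 < 1 - γ := sub_pos.2 h1
  refine ⟨fun i => stateOccupancy M π γ i.1 * (π i.1 i.2).toReal, ⟨fun i => ?_, ?_⟩, fun v => ?_⟩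
  · exact mul_nonneg (mul_nonneg hpos.le (tsum_nonneg fun t =>
      mul_nonneg (pow_nonneg h0 t) ENNReal.toReal_nonneg)) ENNReal.toReal_nonneg
  · rw [Fintype.sum_prod_type]
    have h := sum_stateOccupancy_mul M π h0 h1 fun _ => 1
    simp only [mean_const, mul_one] at h
    rw [tsum_geometric_of_lt_one h0 h1, mul_inv_cancel₀ hpos.ne'] at h
    simpa only [← Finset.mul_sum, sum_toReal_eq_one, mul_one] using h
  · rw [Fintype.sum_prod_type, initMean_value_eq M π h0 h1]
    have e : ∀ s, ∑ a, stateOccupancy M π γ s * (π s a).toReal * advantage γ M v (s, a) =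
        stateOccupancy M π γ s * mean (π s) (M.reward s) + 1 / (1 - γ) *
          (stateOccupancy M π γ s * (γ * mean (policyStep M π s) v - v s)) := fun s => by
      calc _ = stateOccupancy M π γ s * mean (π s) fun a => advantage γ M v (s, a) := by
            rw [mean, Finset.mul_sum]
            exact Finset.sum_congr rfl fun a _ => by ring
        _ = _ := by
            rw [mean_advantage]
            ring
    simp only [e]
    rw [Finset.sum_add_distrib, ← Finset.mul_sum, stateOccupancy_flow M π h0 h1]
    field_simp
    ring

end Value

/-! ### One step of mirror descent -/

/-- The projection of the real line to the unit interval. -/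
def clamp (c : ℝ) : ℝ := max 0 (min 1 c)

theorem clamp_mem (c : ℝ) : 0 ≤ clamp c ∧ clamp c ≤ 1 :=
  ⟨le_max_left _ _, max_le zero_le_one (min_le_left _ _)⟩

/-- The obtuse angle property of the projection onto a convex set. -/
theorem sq_sub_clamp_add_le {y : ℝ} (c : ℝ) (hy : 0 ≤ y ∧ y ≤ 1) :
    (clamp c - c) ^ 2 + (y - clamp c) ^ 2 ≤ (y - c) ^ 2 := by
  obtain ⟨h0, h1⟩ := hy
  unfold clamp
  rcases le_total 1 c with h | h
  · rw [min_eq_left h, max_eq_right zero_le_one]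
    nlinarith
  · rw [min_eq_right h]
    rcases le_total 0 c with h' | h'
    · rw [max_eq_right h']
      nlinarith
    · rw [max_eq_left h']
      nlinarith

/-- The regret bound of one projected gradient step in the unit cube. -/
theorem sum_mul_sub_le_of_clamp {S : Type*} [Fintype S] {β : ℝ} (hβ : 0 < β) (g x : S → ℝ)
    {q : S → ℝ} (hq : ∀ s, 0 ≤ q s ∧ q s ≤ 1) :
    ∑ s, g s * (x s - q s) ≤
      1 / (2 * β) * (∑ s, (x s - q s) ^ 2 - ∑ s, (clamp (x s - β * g s) - q s) ^ 2)
        + β / 2 * ∑ s, g s ^ 2 := by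
  rw [← Finset.sum_sub_distrib, Finset.mul_sum, Finset.mul_sum, ← Finset.sum_add_distrib]
  refine Finset.sum_le_sum fun s _ => ?_
  have h := sq_sub_clamp_add_le (x s - β * g s) (hq s)
  have h2 := sq_nonneg (clamp (x s - β * g s) - (x s - β * g s))
  have h3 : 1 / (2 * β) * (q s - clamp (x s - β * g s)) ^ 2 ≤
      1 / (2 * β) * (q s - (x s - β * g s)) ^ 2 := by
    gcongr 1 / (2 * β) * ?_
    linarith
  have h4 : 1 / (2 * β) * (q s - (x s - β * g s)) ^ 2 =
      1 / (2 * β) * (x s - q s) ^ 2 - g s * (x s - q s) + β / 2 * g s ^ 2 := by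
    field_simp
    ring
  have h5 : (q s - clamp (x s - β * g s)) ^ 2 = (clamp (x s - β * g s) - q s) ^ 2 := by ring
  rw [h5] at h3
  rw [mul_sub]
  linarith

/-- The Kullback-Leibler divergence of two functions on a finite type. -/
def klSum {ι : Type*} [Fintype ι] (ν μ : ι → ℝ) : ℝ := ∑ i, ν i * Real.log (ν i / μ i)

/-! ### Relative entropy and exponential weights -/

section KL

variable {ι : Type*} [Fintype ι] {μ ν : ι → ℝ}

theorem klSum_eq_sum_klFun (hμ : ∀ i, 0 < μ i) (h1 : ∑ i, μ i = 1) (hν : ∑ i, ν i = 1) :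
    klSum ν μ = ∑ i, μ i * InformationTheory.klFun (ν i / μ i) := by
  have e : ∀ i, μ i * InformationTheory.klFun (ν i / μ i) =
      ν i * Real.log (ν i / μ i) + (μ i - ν i) := fun i => by
    have := (hμ i).ne'
    rw [InformationTheory.klFun]
    field_simp
    ring
  simp only [e]
  rw [Finset.sum_add_distrib, Finset.sum_sub_distrib, h1, hν, sub_self, add_zero, klSum]

theorem klSum_nonneg (hμ : ∀ i, 0 < μ i) (h1 : ∑ i, μ i = 1) (hν : ν ∈ stdSimplex ℝ ι) :
    0 ≤ klSum ν μ := by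
  rw [klSum_eq_sum_klFun hμ h1 hν.2]
  exact Finset.sum_nonneg fun i _ => mul_nonneg (hμ i).le
    (InformationTheory.klFun_nonneg (div_nonneg (hν.1 i) (hμ i).le))

theorem eq_of_klSum_nonpos (hμ : ∀ i, 0 < μ i) (h1 : ∑ i, μ i = 1) (hν : ν ∈ stdSimplex ℝ ι)
    (h : klSum ν μ ≤ 0) : ν = μ := by
  have hdiv : ∀ i, 0 ≤ ν i / μ i := fun i => div_nonneg (hν.1 i) (hμ i).le
  have hz := le_antisymm h (klSum_nonneg hμ h1 hν)
  rw [klSum_eq_sum_klFun hμ h1 hν.2, Finset.sum_eq_zero_iff_of_nonneg fun i _ =>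
    mul_nonneg (hμ i).le (InformationTheory.klFun_nonneg (hdiv i))] at hz
  funext i
  have := (mul_eq_zero.1 (hz i (Finset.mem_univ i))).resolve_left (hμ i).ne'
  rw [InformationTheory.klFun_eq_zero_iff (hdiv i)] at this
  rwa [div_eq_one_iff_eq (hμ i).ne'] at this

theorem klSum_uniform_le [Nonempty ι] (hν : ν ∈ stdSimplex ℝ ι) :
    klSum ν (fun _ => 1 / (Fintype.card ι : ℝ)) ≤ Real.log (Fintype.card ι) := by
  have hc : (0 : ℝ) < Fintype.card ι := by exact_mod_cast Fintype.card_pos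
  calc klSum ν (fun _ => 1 / (Fintype.card ι : ℝ))
      ≤ ∑ i, ν i * Real.log (Fintype.card ι) := by
        refine Finset.sum_le_sum fun i _ => ?_
        rcases (hν.1 i).eq_or_lt with h | h
        · simp [← h]
        · refine mul_le_mul_of_nonneg_left (Real.log_le_log (by positivity) ?_) h.le
          have h1 : ν i ≤ 1 :=
            (Finset.single_le_sum (fun j _ => hν.1 j) (Finset.mem_univ i)).trans_eq hν.2
          rw [div_div_eq_mul_div, div_one]
          exact mul_le_of_le_one_left hc.le h1
    _ = Real.log (Fintype.card ι) := by rw [← Finset.sum_mul, hν.2, one_mul]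

/-- The normalizing constant of the exponential weights update. -/
def expZ (η : ℝ) (g μ : ι → ℝ) : ℝ := ∑ i, μ i * Real.exp (-(η * g i))

/-- The exponential weights update. -/
def expUpdate (η : ℝ) (g μ : ι → ℝ) (i : ι) : ℝ := μ i * Real.exp (-(η * g i)) / expZ η g μ

variable (η : ℝ) (g : ι → ℝ)

theorem expZ_pos (hμ : ∀ i, 0 < μ i) (h1 : ∑ i, μ i = 1) : 0 < expZ η g μ := by
  refine Finset.sum_pos (fun i _ => mul_pos (hμ i) (Real.exp_pos _)) ?_
  by_contra h
  rw [Finset.not_nonempty_iff_eq_empty] at h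
  simp [h] at h1

theorem expUpdate_pos (hμ : ∀ i, 0 < μ i) (h1 : ∑ i, μ i = 1) (i : ι) :
    0 < expUpdate η g μ i :=
  div_pos (mul_pos (hμ i) (Real.exp_pos _)) (expZ_pos η g hμ h1)

theorem sum_expUpdate (hμ : ∀ i, 0 < μ i) (h1 : ∑ i, μ i = 1) : ∑ i, expUpdate η g μ i = 1 := by
  simp only [expUpdate]
  rw [← Finset.sum_div]
  exact div_self (expZ_pos η g hμ h1).ne'

/-- This identity serves twice: it shows that the exponential update minimizes the entropic
objective, and it makes the divergence to a comparator telescope in the regret bound. -/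
theorem klSum_expUpdate (hμ : ∀ i, 0 < μ i) (h1 : ∑ i, μ i = 1) (hν : ν ∈ stdSimplex ℝ ι) :
    klSum ν (expUpdate η g μ) = klSum ν μ + η * ∑ i, g i * ν i + Real.log (expZ η g μ) := by
  have hZ := expZ_pos η g hμ h1
  have e : ∀ i, ν i * Real.log (ν i / expUpdate η g μ i) =
      ν i * Real.log (ν i / μ i) + η * (g i * ν i) + ν i * Real.log (expZ η g μ) := fun i => by
    rcases (hν.1 i).eq_or_lt with h | h
    · simp [← h]
    · have e' : ν i / expUpdate η g μ i =
          ν i / μ i * Real.exp (η * g i) * expZ η g μ := by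
        have := (hμ i).ne'
        rw [expUpdate, Real.exp_neg]
        field_simp
      have := div_pos h (hμ i)
      rw [e', Real.log_mul (by positivity) hZ.ne', Real.log_mul this.ne' (Real.exp_ne_zero _),
        Real.log_exp]
      ring
  simp only [klSum, e]
  rw [Finset.sum_add_distrib, Finset.sum_add_distrib, ← Finset.mul_sum, ← Finset.sum_mul, hν.2,
    one_mul]

/-- This follows from (1 + t + t²/2)(1 - t + t²/2) = 1 + t⁴/4 ≥ 1. No upper bound on t is required,
so nonnegative losses may be large. -/
theorem exp_neg_le_quadratic {t : ℝ} (ht : 0 ≤ t) : Real.exp (-t) ≤ 1 - t + t ^ 2 / 2 := by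
  have h := Real.quadratic_le_exp_of_nonneg ht
  have h2 : 0 < 1 - t + t ^ 2 / 2 := by nlinarith [sq_nonneg (t - 1)]
  rw [Real.exp_neg, inv_le_iff_one_le_mul₀ (Real.exp_pos t)]
  nlinarith [sq_nonneg (t ^ 2)]

/-- The regret bound of one exponential weights step with nonnegative losses. -/
theorem sum_mul_sub_le_of_expUpdate (hη : 0 < η) (hg : ∀ i, 0 ≤ g i) (hμ : ∀ i, 0 < μ i)
    (h1 : ∑ i, μ i = 1) (hν : ν ∈ stdSimplex ℝ ι) :
    ∑ i, g i * (μ i - ν i) ≤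
      1 / η * (klSum ν μ - klSum ν (expUpdate η g μ)) + η / 2 * ∑ i, μ i * g i ^ 2 := by
  have hZ := expZ_pos η g hμ h1
  have hle : expZ η g μ ≤ 1 - η * ∑ i, g i * μ i + η ^ 2 / 2 * ∑ i, μ i * g i ^ 2 := by
    rw [← h1, Finset.mul_sum, Finset.mul_sum, ← Finset.sum_sub_distrib, ← Finset.sum_add_distrib]
    refine Finset.sum_le_sum fun i _ => ?_
    calc μ i * Real.exp (-(η * g i)) ≤ μ i * (1 - η * g i + (η * g i) ^ 2 / 2) :=
          mul_le_mul_of_nonneg_left (exp_neg_le_quadratic (mul_nonneg hη.le (hg i))) (hμ i).le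
      _ = _ := by ring
  have hlog : Real.log (expZ η g μ) ≤ -(η * ∑ i, g i * μ i) + η ^ 2 / 2 * ∑ i, μ i * g i ^ 2 := by
    linarith [Real.log_le_sub_one_of_pos hZ]
  rw [klSum_expUpdate η g hμ h1 hν]
  have e : ∑ i, g i * (μ i - ν i) = ∑ i, g i * μ i - ∑ i, g i * ν i := by
    rw [← Finset.sum_sub_distrib]
    exact Finset.sum_congr rfl fun i _ => by ring
  rw [e]
  refine le_of_mul_le_mul_left ?_ hη
  have e2 : η * (1 / η * (klSum ν μ - (klSum ν μ + η * ∑ i, g i * ν i + Real.log (expZ η g μ)))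
      + η / 2 * ∑ i, μ i * g i ^ 2) =
      -(η * ∑ i, g i * ν i) - Real.log (expZ η g μ) + η ^ 2 / 2 * ∑ i, μ i * g i ^ 2 := by
    field_simp
    ring
  rw [e2]
  linarith

end KL

/-! ### The mirror descent step in closed form -/

section Step

variable {S A : Type*} [Fintype S] [Fintype A] {η : ℝ}

theorem mdObjective_mdStep_le (η : ℝ) (g : Vec S A) (x z : Decision S A) :
    mdObjective η g x.1 (mdStep η g x).1 ≤ mdObjective η g x.1 z.1 :=
  (exists_mdStep η g x).choose_spec z

/-- The objective separates into v and μ. Completing the square leaves a Euclidean projection onto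
the cube, and the weight 1/(2|S|) of the divergence makes the step size η|S|. -/
theorem mdStep_fst [Nonempty S] (hη : 0 < η) (g : Vec S A) (x : Decision S A) (s : S) :
    (mdStep η g x).1.1 s = clamp (x.1.1 s - η * Fintype.card S * g.1 s) := by
  set y := mdStep η g x with hy
  have hc : (0 : ℝ) < Fintype.card S := by exact_mod_cast Fintype.card_pos
  set c : S → ℝ := fun s => x.1.1 s - η * Fintype.card S * g.1 s with hcdef
  have e : ∀ q : S → ℝ, ∀ ν : S × A → ℝ, mdObjective η g x.1 (q, ν) =
      1 / (2 * η * Fintype.card S) * ∑ s, (q s - c s) ^ 2 +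
        (∑ s, (g.1 s * x.1.1 s - η * Fintype.card S / 2 * g.1 s ^ 2) + ∑ i, g.2 i * ν i
          + 1 / η * klSum ν x.1.2) := by
    intro q ν
    have : ∑ s, g.1 s * q s + 1 / η * (1 / (2 * (Fintype.card S : ℝ)) *
          ∑ s, (q s - x.1.1 s) ^ 2) = 1 / (2 * η * Fintype.card S) * ∑ s, (q s - c s) ^ 2 +
        ∑ s, (g.1 s * x.1.1 s - η * Fintype.card S / 2 * g.1 s ^ 2) := by
      simp only [Finset.mul_sum]
      rw [← Finset.sum_add_distrib, ← Finset.sum_add_distrib]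
      refine Finset.sum_congr rfl fun s _ => ?_
      simp only [hcdef]
      field_simp
      ring
    simp only [mdObjective, bregman, klSum]
    linear_combination this
  have hle := mdObjective_mdStep_le η g x ⟨(fun s => clamp (c s), y.1.2),
    fun s => clamp_mem _, y.2.2⟩
  rw [← hy] at hle
  have e1 := e y.1.1 y.1.2
  rw [Prod.mk.eta] at e1
  rw [e1, e] at hle
  have hle' : ∑ s, (y.1.1 s - c s) ^ 2 ≤ ∑ s, (clamp (c s) - c s) ^ 2 :=
    le_of_mul_le_mul_left (by linarith : 1 / (2 * η * (Fintype.card S : ℝ)) * _ ≤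
      1 / (2 * η * (Fintype.card S : ℝ)) * _) (by positivity)
  have hsum : ∑ s, ((clamp (c s) - c s) ^ 2 + (y.1.1 s - clamp (c s)) ^ 2) ≤
      ∑ s, (y.1.1 s - c s) ^ 2 :=
    Finset.sum_le_sum fun s _ => sq_sub_clamp_add_le (c s) (y.2.1 s)
  rw [Finset.sum_add_distrib] at hsum
  have h0 : ∑ s, (y.1.1 s - clamp (c s)) ^ 2 = 0 :=
    le_antisymm (by linarith) (Finset.sum_nonneg fun s _ => sq_nonneg _)
  have := (Finset.sum_eq_zero_iff_of_nonneg fun s _ => sq_nonneg _).1 h0 s (Finset.mem_univ s)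
  exact sub_eq_zero.1 (pow_eq_zero_iff two_ne_zero |>.1 this)

/-- By `klSum_expUpdate`, the μ-part of the objective times η is the divergence to the exponential
update plus a constant, so the minimizer has divergence zero. -/
theorem mdStep_snd (hη : 0 < η) (g : Vec S A) (x : Decision S A) (hx : ∀ i, 0 < x.1.2 i) :
    (mdStep η g x).1.2 = expUpdate η g.2 x.1.2 := by
  set y := mdStep η g x with hy
  have h1 : ∑ i, x.1.2 i = 1 := x.2.2.2
  have hpos := expUpdate_pos η g.2 hx h1
  have hone := sum_expUpdate η g.2 hx h1
  have hmem : expUpdate η g.2 x.1.2 ∈ stdSimplex ℝ (S × A) := ⟨fun i => (hpos i).le, hone⟩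
  refine eq_of_klSum_nonpos hpos hone y.2.2 ?_
  have hle := mdObjective_mdStep_le η g x ⟨(y.1.1, expUpdate η g.2 x.1.2), y.2.1, hmem⟩
  rw [← hy] at hle
  simp only [mdObjective, bregman, mul_add] at hle
  have hself : klSum (expUpdate η g.2 x.1.2) (expUpdate η g.2 x.1.2) = 0 :=
    Finset.sum_eq_zero fun i _ => by rw [div_self (hpos i).ne', Real.log_one, mul_zero]
  have k1 := klSum_expUpdate η g.2 hx h1 y.2.2
  have k2 := klSum_expUpdate η g.2 hx h1 hmem
  have hle' : ∑ i, g.2 i * y.1.2 i + 1 / η * klSum y.1.2 x.1.2 ≤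
      ∑ i, g.2 i * expUpdate η g.2 x.1.2 i + 1 / η * klSum (expUpdate η g.2 x.1.2) x.1.2 := by
    simp only [klSum]
    linarith
  have hle'' := mul_le_mul_of_nonneg_left hle' hη.le
  rw [mul_add, mul_add, ← mul_assoc, ← mul_assoc, mul_one_div_cancel hη.ne', one_mul,
    one_mul] at hle''
  linarith

end Step

/-! ### The samples of one round -/

section Round

variable {S A : Type*} [Fintype S] [Fintype A] [Nonempty S] [Nonempty A] {γ η : ℝ}

/-- The law of the samples `(s₀, i, s', j, t')` that are drawn in one round from `x`. -/
def roundLaw (M : MDP S A) (x : Decision S A) : PMF (S × (S × A) × S × (S × A) × S) :=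
  M.init.bind fun s₀ => (flowPMF x).bind fun i => (M.trans i.1 i.2).bind fun s' =>
    (PMF.uniformOfFintype (S × A)).bind fun j => (M.trans j.1 j.2).bind fun t' =>
      PMF.pure (s₀, i, s', j, t')

theorem mean_roundLaw (M : MDP S A) (x : Decision S A)
    (f : S × (S × A) × S × (S × A) × S → ℝ) :
    mean (roundLaw M x) f =
      mean M.init fun s₀ => mean (flowPMF x) fun i => mean (M.trans i.1 i.2) fun s' =>
        mean (PMF.uniformOfFintype (S × A)) fun j => mean (M.trans j.1 j.2) fun t' =>
          f (s₀, i, s', j, t') := by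
  simp only [roundLaw, mean_bind, mean_pure]

omit [Nonempty S] [Nonempty A] in
theorem mean_flowPMF (x : Decision S A) (f : S × A → ℝ) :
    mean (flowPMF x) f = ∑ i, x.1.2 i * f i := by
  refine Finset.sum_congr rfl fun i _ => ?_
  rw [flowPMF, PMF.ofFintype_apply, ENNReal.toReal_ofReal (x.2.2.1 i)]

/-- The gradient that is built from the samples of one round. -/
def roundGradient (γ : ℝ) (M : MDP S A) (x : Decision S A)
    (ω : S × (S × A) × S × (S × A) × S) : Vec S A :=
  sampledGradient γ x.1 ω.1 ω.2.1 ω.2.2.1 ω.2.2.2.1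
    (M.reward ω.2.2.2.1.1 ω.2.2.2.1.2) ω.2.2.2.2

/-- The sampled loss of the state-action pair `j` with successor `t'`. -/
def sampledLoss (γ : ℝ) (M : MDP S A) (x : Decision S A) (j : S × A) (t' : S) : ℝ :=
  1 / (1 - γ) - M.reward j.1 j.2 - 1 / (1 - γ) * (γ * x.1.1 t' - x.1.1 j.1)

omit [Nonempty S] [Nonempty A] in
theorem roundGradient_fst_pairing (M : MDP S A) (x : Decision S A)
    (ω : S × (S × A) × S × (S × A) × S) (q : S → ℝ) :
    ∑ s, (roundGradient γ M x ω).1 s * q s =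
      q ω.1 + 1 / (1 - γ) * (γ * q ω.2.2.1 - q ω.2.1.1) := by
  classical
  simp only [roundGradient, sampledGradient, Pi.add_apply, Pi.smul_apply, Pi.sub_apply,
    smul_eq_mul, add_mul, sub_mul, mul_assoc, Finset.sum_add_distrib, ← Finset.mul_sum,
    Finset.sum_sub_distrib, Pi.single_apply, ite_mul, one_mul, zero_mul, Finset.sum_ite_eq',
    Finset.mem_univ, if_true]

omit [Nonempty S] [Nonempty A] in
theorem sum_roundGradient_snd (M : MDP S A) (x : Decision S A)
    (ω : S × (S × A) × S × (S × A) × S) (F : S × A → ℝ → ℝ) (hF : ∀ i, F i 0 = 0) :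
    ∑ i, F i ((roundGradient γ M x ω).2 i) =
      F ω.2.2.2.1 (Fintype.card (S × A) * sampledLoss γ M x ω.2.2.2.1 ω.2.2.2.2) := by
  classical
  rw [Finset.sum_eq_single ω.2.2.2.1]
  · simp only [roundGradient, sampledGradient, Pi.smul_apply, smul_eq_mul, sampledLoss]
    rw [Pi.single_eq_same]
  · intro i _ hi
    simp only [roundGradient, sampledGradient, Pi.smul_apply, smul_eq_mul]
    rw [Pi.single_eq_of_ne hi, mul_zero, hF]
  · simp

-- The shift by 1/(1-γ) is there to make the losses nonnegative, as the exponential weights bound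
-- requires. It does not affect the regret, since both flows have mass one.
omit [Nonempty S] [Nonempty A] in
theorem sampledLoss_mem (h0 : 0 ≤ γ) (h1 : γ < 1) (M : MDP S A) (x : Decision S A) (j : S × A)
    (t' : S) : 0 ≤ sampledLoss γ M x j t' ∧ sampledLoss γ M x j t' ≤ 2 / (1 - γ) := by
  have hpos : 0 < 1 - γ := sub_pos.2 h1
  obtain ⟨a0, a1⟩ := x.2.1 t'
  obtain ⟨b0, b1⟩ := x.2.1 j.1
  obtain ⟨r0, r1⟩ := M.reward_mem j.1 j.2
  have e : sampledLoss γ M x j t' =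
      (1 - (1 - γ) * M.reward j.1 j.2 - (γ * x.1.1 t' - x.1.1 j.1)) / (1 - γ) := by
    rw [sampledLoss]
    field_simp
  have k1 : γ * x.1.1 t' ≤ γ := mul_le_of_le_one_right h0 a1
  have k2 : 0 ≤ γ * x.1.1 t' := mul_nonneg h0 a0
  have k3 : (1 - γ) * M.reward j.1 j.2 ≤ 1 - γ := mul_le_of_le_one_right hpos.le r1
  have k4 : 0 ≤ (1 - γ) * M.reward j.1 j.2 := mul_nonneg hpos.le r0
  rw [e]
  exact ⟨div_nonneg (by linarith) hpos.le, div_le_div_of_nonneg_right (by linarith) hpos.le⟩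

omit [Nonempty S] [Nonempty A] in
theorem roundGradient_snd_nonneg (h0 : 0 ≤ γ) (h1 : γ < 1) (M : MDP S A) (x : Decision S A)
    (ω : S × (S × A) × S × (S × A) × S) (i : S × A) : 0 ≤ (roundGradient γ M x ω).2 i := by
  classical
  have h := sum_roundGradient_snd (γ := γ) M x ω (fun k y => if k = i then y else 0) (by simp)
  rw [Finset.sum_ite_eq'] at h
  simp only [Finset.mem_univ, if_true] at h
  rw [h]
  split_ifs
  · exact mul_nonneg (Nat.cast_nonneg _) (sampledLoss_mem h0 h1 M x _ _).1
  · exact le_rfl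

omit [Nonempty S] [Nonempty A] in
theorem abs_roundGradient_fst_pairing_le (h0 : 0 ≤ γ) (h1 : γ < 1) (M : MDP S A)
    (x : Decision S A) (ω : S × (S × A) × S × (S × A) × S) {q : S → ℝ} {b : ℝ}
    (hq : ∀ s, |q s| ≤ b) :
    |∑ s, (roundGradient γ M x ω).1 s * q s| ≤ 2 / (1 - γ) * b := by
  have hpos : 0 < 1 - γ := sub_pos.2 h1
  rw [roundGradient_fst_pairing]
  have e : 2 / (1 - γ) * b = b + 1 / (1 - γ) * (γ * b + b) := by
    field_simp
    ring
  rw [e]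
  refine (abs_add_le _ _).trans (add_le_add (hq _) ?_)
  rw [abs_mul, abs_of_pos (by positivity : 0 < 1 / (1 - γ))]
  refine mul_le_mul_of_nonneg_left ?_ (by positivity)
  refine (abs_sub _ _).trans (add_le_add ?_ (hq _))
  rw [abs_mul, abs_of_nonneg h0]
  exact mul_le_mul_of_nonneg_left (hq _) h0

/-- A functional on `ℝ^S` of norm `b` with respect to the maximum norm has Euclidean norm at
most `b`. -/
theorem sum_sq_le_of_pairing_le {ι : Type*} [Fintype ι] {g : ι → ℝ} {b : ℝ}
    (h : ∀ (q : ι → ℝ) (c : ℝ), (∀ s, |q s| ≤ c) → |∑ s, g s * q s| ≤ b * c) :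
    ∑ s, g s ^ 2 ≤ b ^ 2 := by
  classical
  have hg : ∀ s, |g s| ≤ b := fun s => by
    have := h (Pi.single s 1) 1 fun t => by
      rw [Pi.single_apply]
      split_ifs <;> simp
    simpa [Pi.single_apply] using this
  have := (le_abs_self _).trans (h g b hg)
  simpa only [pow_two] using this

/-- The `v`-part of the expected gradient. -/
def meanGradient (γ : ℝ) (M : MDP S A) (x : Decision S A) (s : S) : ℝ :=
  mean (roundLaw M x) fun ω => (roundGradient γ M x ω).1 s

theorem meanGradient_pairing (M : MDP S A) (x : Decision S A) (q : S → ℝ) :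
    ∑ s, meanGradient γ M x s * q s =
      mean (roundLaw M x) fun ω => ∑ s, (roundGradient γ M x ω).1 s * q s := by
  rw [mean_sum]
  refine Finset.sum_congr rfl fun s _ => ?_
  rw [mul_comm, meanGradient, ← mean_const_mul]
  simp only [mul_comm]

theorem meanGradient_pairing_eq (M : MDP S A) (x : Decision S A) (q : S → ℝ) :
    ∑ s, meanGradient γ M x s * q s =
      initMean M q + ∑ i, x.1.2 i * (advantage γ M q i - M.reward i.1 i.2) := by
  rw [meanGradient_pairing, mean_roundLaw]
  simp only [roundGradient_fst_pairing, mean_const, mean_add, mean_const_mul, mean_sub,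
    mean_flowPMF, advantage]
  congr 1
  simp only [Finset.mul_sum, ← Finset.sum_sub_distrib]
  exact Finset.sum_congr rfl fun i _ => by ring

/-- The factor K in the gradient cancels the probability 1/K of each pair. -/
theorem mean_roundGradient_snd_pairing (M : MDP S A) (x : Decision S A) (q : S × A → ℝ) :
    (mean (roundLaw M x) fun ω => ∑ i, (roundGradient γ M x ω).2 i * q i) =
      ∑ i, q i * (1 / (1 - γ) - advantage γ M x.1.1 i) := by
  have hc : (Fintype.card (S × A) : ℝ) ≠ 0 := by exact_mod_cast Fintype.card_ne_zero
  rw [mean_roundLaw]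
  have e : ∀ ω, ∑ i, (roundGradient γ M x ω).2 i * q i =
      Fintype.card (S × A) * q ω.2.2.2.1 * sampledLoss γ M x ω.2.2.2.1 ω.2.2.2.2 := fun ω => by
    rw [sum_roundGradient_snd M x ω (fun i y => y * q i) (by simp)]
    ring
  simp only [e, mean_const, mean_uniform, mean_const_mul, sampledLoss, mean_sub, advantage]
  rw [Finset.mul_sum]
  refine Finset.sum_congr rfl fun i _ => ?_
  field_simp
  ring

/-- The noise of the `v`-part of the sampled gradient. -/
def gradientNoise (γ : ℝ) (M : MDP S A) (x : Decision S A)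
    (ω : S × (S × A) × S × (S × A) × S) (s : S) : ℝ :=
  meanGradient γ M x s - (roundGradient γ M x ω).1 s

theorem gradientNoise_pairing (M : MDP S A) (x : Decision S A)
    (ω : S × (S × A) × S × (S × A) × S) (q : S → ℝ) :
    ∑ s, gradientNoise γ M x ω s * q s =
      ∑ s, meanGradient γ M x s * q s - ∑ s, (roundGradient γ M x ω).1 s * q s := by
  rw [← Finset.sum_sub_distrib]
  exact Finset.sum_congr rfl fun s _ => sub_mul _ _ _

theorem abs_gradientNoise_pairing_le (h0 : 0 ≤ γ) (h1 : γ < 1) (M : MDP S A)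
    (x : Decision S A) (ω : S × (S × A) × S × (S × A) × S) (q : S → ℝ) (b : ℝ)
    (hq : ∀ s, |q s| ≤ b) :
    |∑ s, gradientNoise γ M x ω s * q s| ≤ 4 / (1 - γ) * b := by
  have k1 := abs_roundGradient_fst_pairing_le h0 h1 M x ω hq
  have k2 : |∑ s, meanGradient γ M x s * q s| ≤ 2 / (1 - γ) * b := by
    rw [meanGradient_pairing]
    exact abs_mean_le _ fun ω => abs_roundGradient_fst_pairing_le h0 h1 M x ω hq
  rw [gradientNoise_pairing]
  refine ((abs_sub _ _).trans (add_le_add k2 k1)).trans_eq ?_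
  ring

/-! ### The regret of one round -/

/-- An auxiliary projected gradient step with the noise of the gradient. -/
def ghostStep (γ η : ℝ) (M : MDP S A) (x : Decision S A) (u : S → ℝ)
    (ω : S × (S × A) × S × (S × A) × S) (s : S) : ℝ :=
  clamp (u s - η * Fintype.card S * gradientNoise γ M x ω s)

/-- The part of the regret of one round that depends on the samples: martingale differences, and
the local norm of the `μ`-part of the sampled gradient. -/
def roundIncrement (γ η : ℝ) (M : MDP S A) (ν : S × A → ℝ) (x : Decision S A) (u : S → ℝ)
    (ω : S × (S × A) × S × (S × A) × S) : ℝ :=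
  ∑ s, gradientNoise γ M x ω s * (x.1.1 s - u s) +
    ((mean (roundLaw M x) fun ω' => ∑ i, (roundGradient γ M x ω').2 i * (x.1.2 i - ν i)) -
      ∑ i, (roundGradient γ M x ω).2 i * (x.1.2 i - ν i)) +
    η / 2 * ∑ i, x.1.2 i * (roundGradient γ M x ω).2 i ^ 2

/-- The distance of the decision `x` and the auxiliary point `u` to the comparator `(q, ν)`. -/
def potential (η : ℝ) (ν : S × A → ℝ) (q : S → ℝ) (x : Decision S A) (u : S → ℝ) : ℝ :=
  1 / (2 * (η * Fintype.card S)) * (∑ s, (x.1.1 s - q s) ^ 2 + ∑ s, (u s - q s) ^ 2) +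
    1 / η * klSum ν x.1.2

/-- Three regret bounds are added: the v-step, the ghost step on the noise, and exponential weights.
The bound holds for every outcome ω and every q, so q may later be chosen in dependence on all
samples. The two Euclidean steps cost η|S|/2 · (2² + 4²)H², which is the last term. -/
theorem regret_round_le (h0 : 0 ≤ γ) (h1 : γ < 1) (hη : 0 < η) (M : MDP S A)
    {ν : S × A → ℝ} (hν : ν ∈ stdSimplex ℝ (S × A)) {J : ℝ}
    (hJ : ∀ v, ∑ i, ν i * advantage γ M v i = J - initMean M v) (x : Decision S A)
    (hx : ∀ i, 0 < x.1.2 i) (u : S → ℝ) (ω : S × (S × A) × S × (S × A) × S) {q : S → ℝ}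
    (hq : ∀ s, 0 ≤ q s ∧ q s ≤ 1) :
    J - initMean M q - ∑ i, x.1.2 i * advantage γ M q i ≤
      roundIncrement γ η M ν x u ω + potential η ν q x u -
        potential η ν q (mdStep η (roundGradient γ M x ω) x) (ghostStep γ η M x u ω) +
        10 * η * Fintype.card S * (1 / (1 - γ)) ^ 2 := by
  have hc : (0 : ℝ) < Fintype.card S := by exact_mod_cast Fintype.card_pos
  have hβ : 0 < η * Fintype.card S := mul_pos hη hc
  have r1 := sum_mul_sub_le_of_clamp hβ (roundGradient γ M x ω).1 x.1.1 hq
  have r2 := sum_mul_sub_le_of_clamp hβ (gradientNoise γ M x ω) u hq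
  have r3 := sum_mul_sub_le_of_expUpdate η (roundGradient γ M x ω).2 hη
    (roundGradient_snd_nonneg h0 h1 M x ω) hx x.2.2.2 hν
  have n1 : ∑ s, (roundGradient γ M x ω).1 s ^ 2 ≤ (2 / (1 - γ)) ^ 2 :=
    sum_sq_le_of_pairing_le fun q c hq => abs_roundGradient_fst_pairing_le h0 h1 M x ω hq
  have n2 : ∑ s, gradientNoise γ M x ω s ^ 2 ≤ (4 / (1 - γ)) ^ 2 :=
    sum_sq_le_of_pairing_le fun q c hq => abs_gradientNoise_pairing_le h0 h1 M x ω q c hq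
  have n1' := mul_le_mul_of_nonneg_left n1 (by positivity : 0 ≤ η * Fintype.card S / 2)
  have n2' := mul_le_mul_of_nonneg_left n2 (by positivity : 0 ≤ η * Fintype.card S / 2)
  have n3 : η * Fintype.card S / 2 * (2 / (1 - γ)) ^ 2 +
      η * Fintype.card S / 2 * (4 / (1 - γ)) ^ 2 =
      10 * η * Fintype.card S * (1 / (1 - γ)) ^ 2 := by ring
  have p : potential η ν q (mdStep η (roundGradient γ M x ω) x) (ghostStep γ η M x u ω) =
      1 / (2 * (η * Fintype.card S)) *
        (∑ s, (clamp (x.1.1 s - η * Fintype.card S * (roundGradient γ M x ω).1 s) - q s) ^ 2 +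
          ∑ s, (clamp (u s - η * Fintype.card S * gradientNoise γ M x ω s) - q s) ^ 2) +
        1 / η * klSum ν (expUpdate η (roundGradient γ M x ω).2 x.1.2) := by
    simp only [potential, mdStep_fst hη, mdStep_snd hη _ x hx, ghostStep]
  -- Since Λ is affine in each argument, its gap Λ(v, ν) - Λ(q, μ) equals the expected gradient
  -- paired with x - (q, ν); here Λ(v, ν) = J by `hJ`.
  have e1 : J - initMean M q - ∑ i, x.1.2 i * advantage γ M q i =
      ∑ s, meanGradient γ M x s * (x.1.1 s - q s) +
        mean (roundLaw M x) fun ω' => ∑ i, (roundGradient γ M x ω').2 i * (x.1.2 i - ν i) := by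
    rw [mean_roundGradient_snd_pairing]
    simp only [mul_sub, sub_mul, Finset.sum_sub_distrib, meanGradient_pairing_eq, hJ,
      ← Finset.sum_mul, x.2.2.2, hν.2]
    ring
  have e2 := gradientNoise_pairing (γ := γ) M x ω fun s => x.1.1 s - q s
  have e3 : ∑ s, gradientNoise γ M x ω s * (x.1.1 s - q s) =
      ∑ s, gradientNoise γ M x ω s * (x.1.1 s - u s) +
        ∑ s, gradientNoise γ M x ω s * (u s - q s) := by
    rw [← Finset.sum_add_distrib]
    exact Finset.sum_congr rfl fun s _ => by ring
  rw [e1, p, potential, roundIncrement]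
  simp only [mul_add, mul_sub] at r1 r2 r3 e2 e3 n3 ⊢
  simp only [mul_sub] at e1
  linarith

/-! ### The exponential moment of one round -/

/-- A Bernstein-type bound from e^y ≤ 1 + y + y² for |y| ≤ 1, then 1 + z ≤ e^z. -/
theorem mean_exp_le {α : Type*} [Fintype α] (p : PMF α) {Y : α → ℝ} {m σ l : ℝ} (hl : 0 ≤ l)
    (hY : ∀ a, l * |Y a| ≤ 1) (hm : mean p Y ≤ m) (hσ : mean p (fun a => Y a ^ 2) ≤ σ) :
    mean p (fun a => Real.exp (l * Y a)) ≤ Real.exp (l * m + l ^ 2 * σ) := by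
  calc mean p (fun a => Real.exp (l * Y a)) ≤ mean p (fun a => 1 + l * Y a + l ^ 2 * Y a ^ 2) := by
        refine mean_mono p fun a => ?_
        have := Real.abs_exp_sub_one_sub_id_le (x := l * Y a)
          (by rw [abs_mul, abs_of_nonneg hl]; exact hY a)
        have := (abs_le.1 this).2
        linarith [mul_pow l (Y a) 2]
    _ = 1 + l * mean p Y + l ^ 2 * mean p (fun a => Y a ^ 2) := by
        rw [mean_add, mean_add, mean_const, mean_const_mul, mean_const_mul]
    _ ≤ 1 + l * m + l ^ 2 * σ := by gcongr
    _ ≤ _ := by linarith [Real.add_one_le_exp (l * m + l ^ 2 * σ)]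

theorem mean_roundLaw_pair (M : MDP S A) (x : Decision S A) (f : S × A → ℝ) :
    mean (roundLaw M x) (fun ω => f ω.2.2.2.1) =
      1 / (Fintype.card (S × A) : ℝ) * ∑ i, f i := by
  simp only [mean_roundLaw, mean_const, mean_uniform]

theorem mem_Icc_of_mem_stdSimplex {ι : Type*} [Fintype ι] {ν : ι → ℝ} (hν : ν ∈ stdSimplex ℝ ι)
    (i : ι) : 0 ≤ ν i ∧ ν i ≤ 1 :=
  ⟨hν.1 i, (Finset.single_le_sum (fun j _ => hν.1 j) (Finset.mem_univ i)).trans_eq hν.2⟩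

/-- The increment is bounded by 4H + 2H + 2KH + 2KH ≤ 10KH. Its square contains K²H² only multiplied
by the masses of μ and ν at the uniformly drawn pair, whose mean is 2/K; this saves one factor K in
the variance. -/
theorem mean_exp_roundIncrement_le (h0 : 0 ≤ γ) (h1 : γ < 1) (hη : 0 < η) (M : MDP S A)
    (hηK : η * Fintype.card (S × A) * (1 / (1 - γ)) ≤ 1)
    {ν : S × A → ℝ} (hν : ν ∈ stdSimplex ℝ (S × A)) (x : Decision S A) {u : S → ℝ}
    (hu : ∀ s, 0 ≤ u s ∧ u s ≤ 1) {l : ℝ} (hl : 0 ≤ l)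
    (hlK : l * (10 * Fintype.card (S × A) * (1 / (1 - γ))) ≤ 1) :
    mean (roundLaw M x) (fun ω => Real.exp (l * roundIncrement γ η M ν x u ω)) ≤
      Real.exp (l * (2 * η * Fintype.card (S × A) * (1 / (1 - γ)) ^ 2) +
        l ^ 2 * (144 * Fintype.card (S × A) * (1 / (1 - γ)) ^ 2)) := by
  have hpos : 0 < 1 - γ := sub_pos.2 h1
  set H := 1 / (1 - γ) with hH
  set K : ℝ := (Fintype.card (S × A) : ℝ) with hK
  have hHpos : 0 < H := by positivity
  have hK1 : 1 ≤ K := by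
    rw [hK]
    exact_mod_cast Fintype.card_pos
  have hloss : ∀ j t, 0 ≤ sampledLoss γ M x j t ∧ sampledLoss γ M x j t ≤ 2 * H := fun j t => by
    have := sampledLoss_mem h0 h1 M x j t
    rwa [hH, mul_one_div]
  have hμν : ∀ i, |x.1.2 i - ν i| ≤ 1 := fun i => by
    obtain ⟨a, b⟩ := mem_Icc_of_mem_stdSimplex x.2.2 i
    obtain ⟨c, d⟩ := mem_Icc_of_mem_stdSimplex hν i
    exact abs_le.2 ⟨by linarith, by linarith⟩
  set a := fun ω => ∑ s, gradientNoise γ M x ω s * (x.1.1 s - u s) with ha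
  set b := fun ω => ∑ i, (roundGradient γ M x ω).2 i * (x.1.2 i - ν i) with hb
  set c := fun ω => η / 2 * ∑ i, x.1.2 i * (roundGradient γ M x ω).2 i ^ 2 with hc
  have hY : ∀ ω, roundIncrement γ η M ν x u ω = a ω + (mean (roundLaw M x) b - b ω) + c ω :=
    fun ω => rfl
  have hvu : ∀ s, |x.1.1 s - u s| ≤ 1 := fun s => by
    obtain ⟨a, b⟩ := x.2.1 s
    obtain ⟨c, d⟩ := hu s
    exact abs_le.2 ⟨by linarith, by linarith⟩
  have ha_abs : ∀ ω, |a ω| ≤ 4 * H := fun ω =>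
    (abs_gradientNoise_pairing_le h0 h1 M x ω _ 1 hvu).trans_eq (by rw [hH]; ring)
  have ha_mean : mean (roundLaw M x) a = 0 := by
    simp only [ha, gradientNoise_pairing, mean_sub, mean_const, meanGradient_pairing, sub_self]
  have hb_eq : ∀ ω, b ω = K * sampledLoss γ M x ω.2.2.2.1 ω.2.2.2.2 *
      (x.1.2 ω.2.2.2.1 - ν ω.2.2.2.1) := fun ω =>
    sum_roundGradient_snd M x ω (fun i y => y * (x.1.2 i - ν i)) (by simp)
  have hc_eq : ∀ ω, c ω = η / 2 * (x.1.2 ω.2.2.2.1 *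
      (K * sampledLoss γ M x ω.2.2.2.1 ω.2.2.2.2) ^ 2) := fun ω => by
    rw [hc]
    simp only
    rw [sum_roundGradient_snd M x ω (fun i y => x.1.2 i * y ^ 2) (by simp)]
  have hKl : ∀ j t, 0 ≤ K * sampledLoss γ M x j t ∧ K * sampledLoss γ M x j t ≤ 2 * K * H :=
    fun j t => ⟨mul_nonneg (by linarith) (hloss j t).1, by nlinarith [(hloss j t).2]⟩
  have hb_abs : ∀ ω, |b ω| ≤ 2 * K * H := fun ω => by
    rw [hb_eq, abs_mul, abs_of_nonneg (hKl _ _).1]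
    exact (mul_le_of_le_one_right (hKl _ _).1 (hμν _)).trans (hKl _ _).2
  have hb_sq : ∀ ω, b ω ^ 2 ≤ 4 * K ^ 2 * H ^ 2 * (x.1.2 ω.2.2.2.1 + ν ω.2.2.2.1) := fun ω => by
    rw [hb_eq, mul_pow]
    have k1 := pow_le_pow_left₀ (hKl ω.2.2.2.1 ω.2.2.2.2).1 (hKl ω.2.2.2.1 ω.2.2.2.2).2 2
    have k2 : (x.1.2 ω.2.2.2.1 - ν ω.2.2.2.1) ^ 2 ≤ x.1.2 ω.2.2.2.1 + ν ω.2.2.2.1 := by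
      obtain ⟨a, b⟩ := mem_Icc_of_mem_stdSimplex x.2.2 ω.2.2.2.1
      obtain ⟨c, d⟩ := mem_Icc_of_mem_stdSimplex hν ω.2.2.2.1
      nlinarith
    exact (mul_le_mul k1 k2 (sq_nonneg _) (sq_nonneg _)).trans_eq (by ring)
  have hc_le : ∀ ω, c ω ≤ 2 * η * K ^ 2 * H ^ 2 * x.1.2 ω.2.2.2.1 := fun ω => by
    rw [hc_eq]
    have k1 := pow_le_pow_left₀ (hKl ω.2.2.2.1 ω.2.2.2.2).1 (hKl ω.2.2.2.1 ω.2.2.2.2).2 2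
    have k2 := mul_le_mul_of_nonneg_left k1 (x.2.2.1 ω.2.2.2.1)
    have k3 := mul_le_mul_of_nonneg_left k2 (by positivity : 0 ≤ η / 2)
    exact k3.trans_eq (by ring)
  have hc_nonneg : ∀ ω, 0 ≤ c ω := fun ω => by
    rw [hc_eq]
    have := x.2.2.1 ω.2.2.2.1
    positivity
  have hc_le' : ∀ ω, c ω ≤ 2 * K * H * x.1.2 ω.2.2.2.1 := fun ω => by
    refine (hc_le ω).trans (mul_le_mul_of_nonneg_right ?_ (x.2.2.1 _))
    calc 2 * η * K ^ 2 * H ^ 2 = 2 * K * H * (η * K * H) := by ring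
      _ ≤ 2 * K * H := mul_le_of_le_one_right (by positivity) hηK
  have hc_abs : ∀ ω, c ω ≤ 2 * K * H := fun ω =>
    (hc_le' ω).trans (mul_le_of_le_one_right (by positivity)
      (mem_Icc_of_mem_stdSimplex x.2.2 _).2)
  have hc_sq : ∀ ω, c ω ^ 2 ≤ 4 * K ^ 2 * H ^ 2 * x.1.2 ω.2.2.2.1 := fun ω => by
    calc c ω ^ 2 = c ω * c ω := pow_two _
      _ ≤ (2 * K * H) * (2 * K * H * x.1.2 ω.2.2.2.1) :=
        mul_le_mul (hc_abs ω) (hc_le' ω) (hc_nonneg ω) (by positivity)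
      _ = _ := by ring
  have hmb : |mean (roundLaw M x) b| ≤ 2 * H := by
    have e : mean (roundLaw M x) b = ∑ i, (x.1.2 i - ν i) * (H - advantage γ M x.1.1 i) :=
      mean_roundGradient_snd_pairing M x _
    have hadv : ∀ i, 0 ≤ H - advantage γ M x.1.1 i ∧ H - advantage γ M x.1.1 i ≤ 2 * H := by
      intro i
      have e' : H - advantage γ M x.1.1 i = mean (M.trans i.1 i.2) (sampledLoss γ M x i) := by
        have e'' : sampledLoss γ M x i = fun t => H - M.reward i.1 i.2 -
            H * (γ * x.1.1 t - x.1.1 i.1) := rfl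
        simp only [e'', mean_sub, mean_const, mean_const_mul, advantage]
        ring
      rw [e']
      exact mean_mem_Icc _ fun t => hloss i t
    have bd : ∀ ρ ∈ stdSimplex ℝ (S × A), 0 ≤ ∑ i, ρ i * (H - advantage γ M x.1.1 i) ∧
        ∑ i, ρ i * (H - advantage γ M x.1.1 i) ≤ 2 * H := fun ρ hρ => by
      refine ⟨Finset.sum_nonneg fun i _ => mul_nonneg (hρ.1 i) (hadv i).1, ?_⟩
      calc _ ≤ ∑ i, ρ i * (2 * H) :=
            Finset.sum_le_sum fun i _ => mul_le_mul_of_nonneg_left (hadv i).2 (hρ.1 i)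
        _ = 2 * H := by rw [← Finset.sum_mul, hρ.2, one_mul]
    obtain ⟨b1, b2⟩ := bd _ x.2.2
    obtain ⟨b3, b4⟩ := bd _ hν
    rw [e]
    simp only [sub_mul, Finset.sum_sub_distrib]
    exact abs_le.2 ⟨by linarith, by linarith⟩
  have hKH : H ≤ K * H := le_mul_of_one_le_left hHpos.le hK1
  refine mean_exp_le _ hl (fun ω => ?_) ?_ ?_
  · refine (mul_le_mul_of_nonneg_left ?_ hl).trans hlK
    rw [hY]
    have p1 := abs_le.1 (ha_abs ω)
    have p2 := abs_le.1 (hb_abs ω)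
    have p3 := abs_le.1 hmb
    have p4 := hc_nonneg ω
    have p5 := hc_abs ω
    exact abs_le.2 ⟨by linarith, by linarith⟩
  · rw [funext hY, mean_add, mean_add, ha_mean, mean_sub, mean_const, sub_self, add_zero, zero_add]
    calc mean (roundLaw M x) c
        ≤ mean (roundLaw M x) fun ω => 2 * η * K ^ 2 * H ^ 2 * x.1.2 ω.2.2.2.1 :=
          mean_mono _ hc_le
      _ = 2 * η * K * H ^ 2 := by
          rw [mean_const_mul, mean_roundLaw_pair, x.2.2.2, ← hK]
          field_simp
  · calc mean (roundLaw M x) (fun ω => roundIncrement γ η M ν x u ω ^ 2)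
        ≤ mean (roundLaw M x) fun ω => 80 * H ^ 2 + 32 * K ^ 2 * H ^ 2 *
            (x.1.2 ω.2.2.2.1 + ν ω.2.2.2.1) := by
          refine mean_mono _ fun ω => ?_
          rw [hY]
          have q1 : a ω ^ 2 ≤ (4 * H) ^ 2 := sq_le_sq' (abs_le.1 (ha_abs ω)).1
            (abs_le.1 (ha_abs ω)).2
          have q2 : mean (roundLaw M x) b ^ 2 ≤ (2 * H) ^ 2 := sq_le_sq' (abs_le.1 hmb).1
            (abs_le.1 hmb).2
          have q3 := hb_sq ω
          have q4 := hc_sq ω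
          have q5 : 0 ≤ 4 * K ^ 2 * H ^ 2 * ν ω.2.2.2.1 := mul_nonneg (by positivity) (hν.1 _)
          -- Cauchy-Schwarz for four terms.
          have q6 : (a ω + (mean (roundLaw M x) b - b ω) + c ω) ^ 2 ≤
              4 * (a ω ^ 2 + mean (roundLaw M x) b ^ 2 + b ω ^ 2 + c ω ^ 2) := by
            generalize mean (roundLaw M x) b = y
            nlinarith [sq_nonneg (a ω - y), sq_nonneg (a ω + b ω), sq_nonneg (a ω - c ω),
              sq_nonneg (y + b ω), sq_nonneg (y - c ω), sq_nonneg (b ω + c ω)]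
          linarith
      _ = 80 * H ^ 2 + 64 * K * H ^ 2 := by
          rw [mean_add, mean_const, mean_const_mul, mean_add, mean_roundLaw_pair,
            mean_roundLaw_pair, x.2.2.2, hν.2, ← hK]
          field_simp
          ring
      _ ≤ 144 * K * H ^ 2 := by nlinarith [sq_nonneg H]

end Round

/-! ### The learned policy -/

theorem toOuterMeasure_bind_le {α β : Type*} [Fintype α] (p : PMF α) (q : α → PMF β) (s : Set β)
    {f : α → ℝ} (hf : ∀ a, 0 ≤ f a)
    (h : ∀ a, (q a).toOuterMeasure s ≤ ENNReal.ofReal (f a)) :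
    (p.bind q).toOuterMeasure s ≤ ENNReal.ofReal (mean p f) := by
  rw [PMF.toOuterMeasure_bind_apply, tsum_fintype, mean, ENNReal.ofReal_sum_of_nonneg
    fun a _ => mul_nonneg ENNReal.toReal_nonneg (hf a)]
  refine Finset.sum_le_sum fun a _ => ?_
  rw [ENNReal.ofReal_mul ENNReal.toReal_nonneg, ENNReal.ofReal_toReal (p.apply_ne_top a)]
  gcongr
  exact h a

/-! ### The Chernoff bound along the program -/

section Loop

variable {S A : Type*} [Fintype S] [Fintype A] [Nonempty S] [Nonempty A] {γ η : ℝ}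

theorem exec_mdLoop_succ_le (M : MDP S A) (N m : ℕ) (x : Decision S A) (acc : Vec S A)
    (Q : Policy S A → Prop) {F : S × (S × A) × S × (S × A) × S → ℝ} (hF : ∀ ω, 0 ≤ F ω)
    (h : ∀ ω, ((mdLoop γ η N m (mdStep η (roundGradient γ M x ω) x) (acc + x.1)).exec
      M).toOuterMeasure {o | Q o.1} ≤ ENNReal.ofReal (F ω)) :
    ((mdLoop γ η N (m + 1) x acc).exec M).toOuterMeasure {o | Q o.1} ≤
      ENNReal.ofReal (mean (roundLaw M x) F) := by
  have hmap : ∀ p : PMF (Policy S A × ℕ),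
      (p.map fun o => (o.1, o.2 + 1)).toOuterMeasure {o | Q o.1} =
        p.toOuterMeasure {o | Q o.1} := fun p => by
    rw [PMF.toOuterMeasure_map_apply]
    rfl
  rw [mean_roundLaw]
  simp only [mdLoop, GenProg.exec]
  refine toOuterMeasure_bind_le _ _ _ (fun s₀ => mean_nonneg _ fun i => mean_nonneg _ fun s' =>
    mean_nonneg _ fun j => mean_nonneg _ fun t' => hF _) fun s₀ => ?_
  rw [hmap]
  refine toOuterMeasure_bind_le _ _ _ (fun i => mean_nonneg _ fun s' =>
    mean_nonneg _ fun j => mean_nonneg _ fun t' => hF _) fun i => ?_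
  refine toOuterMeasure_bind_le _ _ _ (fun s' => mean_nonneg _ fun j =>
    mean_nonneg _ fun t' => hF _) fun s' => ?_
  rw [hmap]
  refine toOuterMeasure_bind_le _ _ _ (fun j => mean_nonneg _ fun t' => hF _) fun j => ?_
  rw [hmap]
  refine toOuterMeasure_bind_le _ _ _ (fun t' => hF _) fun t' => ?_
  rw [hmap]
  exact h (s₀, i, s', j, t')

/-- A round calls for one initial state, two successors and one reward; the internal coins are free.
-/
theorem calls_mdLoop (M : MDP S A) (N m : ℕ) (x : Decision S A) (acc : Vec S A) :
    ∀ o ∈ ((mdLoop γ η N m x acc).exec M).support, o.2 = 4 * m := by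
  induction m generalizing x acc with
  | zero =>
    intro o ho
    simp only [mdLoop, GenProg.exec, PMF.mem_support_pure_iff] at ho
    rw [ho]
  | succ m ih =>
    intro o ho
    simp only [mdLoop, GenProg.exec, PMF.mem_support_bind_iff, PMF.mem_support_map_iff] at ho
    obtain ⟨s₀, -, o₁, ⟨i, -, s', -, o₂, ⟨j, -, o₃, ⟨t', -, o₄, h₄, rfl⟩, rfl⟩, rfl⟩, rfl⟩ := ho
    have := ih _ _ o₄ h₄
    simp only
    omega

omit [Fintype A] [Nonempty S] [Nonempty A] in
theorem initMean_mem_Icc (M : MDP S A) {f : S → ℝ} (h : ∀ s, 0 ≤ f s ∧ f s ≤ 1) :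
    0 ≤ initMean M f ∧ initMean M f ≤ 1 :=
  mean_mem_Icc M.init h

omit [Nonempty S] [Nonempty A] in
theorem neg_sum_mul_advantage_le (h0 : 0 ≤ γ) (h1 : γ < 1) (M : MDP S A) {μ : S × A → ℝ}
    (hμ : μ ∈ stdSimplex ℝ (S × A)) {q : S → ℝ} (hq : ∀ s, 0 ≤ q s ∧ q s ≤ 1) :
    -∑ i, μ i * advantage γ M q i ≤ 1 / (1 - γ) := by
  have hH : 0 < 1 / (1 - γ) := one_div_pos.2 (sub_pos.2 h1)
  rw [← Finset.sum_neg_distrib]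
  calc ∑ i, -(μ i * advantage γ M q i) ≤ ∑ i, μ i * (1 / (1 - γ)) := by
        refine Finset.sum_le_sum fun i _ => ?_
        rw [← mul_neg]
        refine mul_le_mul_of_nonneg_left ?_ (hμ.1 i)
        have k1 : 0 ≤ γ * mean (M.trans i.1 i.2) q :=
          mul_nonneg h0 (mean_nonneg _ fun s => (hq s).1)
        have k2 := mul_le_mul_of_nonneg_left
          (by linarith [(hq i.1).2] : -(γ * mean (M.trans i.1 i.2) q - q i.1) ≤ 1) hH.le
        have k3 := (M.reward_mem i.1 i.2).1
        rw [advantage]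
        linarith
    _ = 1 / (1 - γ) := by rw [← Finset.sum_mul, hμ.2, one_mul]

/-- The exponential tail bound for the suboptimality of the learned policy with respect to a
policy with occupancy measure `ν` and value `J`. -/
theorem exec_mdLoop_tail (h0 : 0 ≤ γ) (h1 : γ < 1) (hη : 0 < η) (M : MDP S A)
    (hηK : η * Fintype.card (S × A) * (1 / (1 - γ)) ≤ 1)
    {ν : S × A → ℝ} (hν : ν ∈ stdSimplex ℝ (S × A)) {J : ℝ} (hJ1 : J ≤ 1)
    (hJ : ∀ v, ∑ i, ν i * advantage γ M v i = J - initMean M v) {l : ℝ} (hl : 0 ≤ l)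
    (hlK : l * (10 * Fintype.card (S × A) * (1 / (1 - γ))) ≤ 1) (N : ℕ) (T Φ : ℝ) (m : ℕ) :
    ∀ (k : ℕ) (x : Decision S A) (acc : Vec S A) (u : S → ℝ) (W : ℝ), k + m + 1 = N →
      (∀ i, 0 < x.1.2 i) → (∀ i, 0 ≤ acc.2 i) → (∀ s, 0 ≤ u s ∧ u s ≤ 1) →
      (∀ q : S → ℝ, (∀ s, 0 ≤ q s ∧ q s ≤ 1) →
        k * (J - initMean M q) - ∑ i, acc.2 i * advantage γ M q i ≤
          W + Φ - potential η ν q x u + k * (10 * η * Fintype.card S * (1 / (1 - γ)) ^ 2)) →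
      ((mdLoop γ η N m x acc).exec M).toOuterMeasure
          {o | T < N * (J - initMean M (value γ M o.1))} ≤
        ENNReal.ofReal (Real.exp (l * (W + Φ +
            (N - 1) * (10 * η * Fintype.card S * (1 / (1 - γ)) ^ 2) + 2 * (1 / (1 - γ)) - T) +
          m * (l * (2 * η * Fintype.card (S × A) * (1 / (1 - γ)) ^ 2) +
            l ^ 2 * (144 * Fintype.card (S × A) * (1 / (1 - γ)) ^ 2)))) := by
  have hH1 : 1 ≤ 1 / (1 - γ) := by
    rw [le_div_iff₀ (sub_pos.2 h1)]
    linarith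
  set D := 10 * η * (Fintype.card S : ℝ) * (1 / (1 - γ)) ^ 2 with hD
  set E := l * (2 * η * (Fintype.card (S × A) : ℝ) * (1 / (1 - γ)) ^ 2) +
    l ^ 2 * (144 * (Fintype.card (S × A) : ℝ) * (1 / (1 - γ)) ^ 2) with hE
  -- The accumulated increments are carried in `W`, and the regret invariant is kept for all q
  -- simultaneously, because q is fixed only when the program has returned its policy.
  induction m with
  | zero =>
    intro k x acc u W hk hx hacc hu hinv
    have hkN : (N : ℝ) = k + 1 := by
      rw [← hk]
      push_cast
      ring
    simp only [mdLoop, GenProg.exec]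
    set π := flowPolicy ((1 / (N : ℝ)) • (acc + x.1)).2 with hπ
    rw [PMF.toOuterMeasure_pure_apply]
    split_ifs with hmem
    swap
    · exact zero_le
    rw [← ENNReal.ofReal_one]
    -- At the end the outcome is deterministic: if the bad event occurs, the invariant at q = V^π
    -- makes the exponent nonnegative, so the bound is at least 1.
    refine ENNReal.ofReal_le_ofReal (Real.one_le_exp ?_)
    simp only [Set.mem_ofPred_eq] at hmem
    have hval := fun s => value_mem M π h0 h1 s
    have hinv' := hinv (value γ M π) hval
    have hzero := sum_mul_advantage_flowPolicy M h0 h1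
      (μ := ((1 / (N : ℝ)) • (acc + x.1)).2) fun i =>
        mul_nonneg (by positivity) (add_nonneg (hacc i) (hx i).le)
    rw [← hπ] at hzero
    have hzero' : ∑ i, acc.2 i * advantage γ M (value γ M π) i +
        ∑ i, x.1.2 i * advantage γ M (value γ M π) i = 0 := by
      have hN : (N : ℝ) ≠ 0 := by
        rw [hkN]
        positivity
      have e : ∑ i, ((1 / (N : ℝ)) • (acc + x.1)).2 i * advantage γ M (value γ M π) i =
          1 / (N : ℝ) * (∑ i, acc.2 i * advantage γ M (value γ M π) i +
            ∑ i, x.1.2 i * advantage γ M (value γ M π) i) := by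
        rw [← Finset.sum_add_distrib, Finset.mul_sum]
        refine Finset.sum_congr rfl fun i _ => ?_
        simp only [Prod.smul_snd, Prod.snd_add, Pi.smul_apply, Pi.add_apply, smul_eq_mul]
        ring
      rw [e] at hzero
      exact (mul_eq_zero.1 hzero).resolve_left (one_div_ne_zero hN)
    -- The last decision is averaged but not followed by a gradient step, so its regret is bounded
    -- crudely by 1 + H ≤ 2H.
    have hlast := neg_sum_mul_advantage_le h0 h1 M x.2.2 hval
    have hpot : 0 ≤ potential η ν (value γ M π) x u := by
      have := klSum_nonneg hx x.2.2.2 hν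
      unfold potential
      positivity
    have hJv := (initMean_mem_Icc M hval).1
    have hnn : 0 ≤ l * (W + Φ + (N - 1) * D + 2 * (1 / (1 - γ)) - T) := by
      refine mul_nonneg hl ?_
      rw [hkN] at hmem ⊢
      rw [add_mul, one_mul] at hmem
      rw [add_sub_cancel_right]
      linarith
    simpa using hnn
  | succ m ih =>
    intro k x acc u W hk hx hacc hu hinv
    refine (exec_mdLoop_succ_le M N m x acc
      (fun π => T < N * (J - initMean M (value γ M π)))
      (F := fun ω => Real.exp (l * (W + Φ + (N - 1) * D + 2 * (1 / (1 - γ)) - T) + m * E) *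
        Real.exp (l * roundIncrement γ η M ν x u ω)) (fun ω => by positivity)
      fun ω => ?_).trans ?_
    · refine (ih (k + 1) (mdStep η (roundGradient γ M x ω) x) (acc + x.1)
        (ghostStep γ η M x u ω) (W + roundIncrement γ η M ν x u ω) (by omega) ?_ ?_ ?_ ?_).trans_eq
        ?_
      · rw [mdStep_snd hη _ x hx]
        exact expUpdate_pos _ _ hx x.2.2.2
      · exact fun i => add_nonneg (hacc i) (hx i).le
      · exact fun s => clamp_mem _
      · intro q hq
        have k1 := hinv q hq
        have k2 := regret_round_le h0 h1 hη M hν hJ x hx u ω hq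
        rw [← hD] at k2
        have e : ∑ i, (acc + x.1).2 i * advantage γ M q i =
            ∑ i, acc.2 i * advantage γ M q i + ∑ i, x.1.2 i * advantage γ M q i := by
          rw [← Finset.sum_add_distrib]
          exact Finset.sum_congr rfl fun i _ => add_mul _ _ _
        rw [e]
        push_cast
        linarith
      · rw [← Real.exp_add]
        congr 2
        ring
    · rw [mean_const_mul]
      refine ENNReal.ofReal_le_ofReal ?_
      calc _ ≤ Real.exp (l * (W + Φ + (N - 1) * D + 2 * (1 / (1 - γ)) - T) + m * E) *
            Real.exp E := by
            gcongr
            exact mean_exp_roundIncrement_le h0 h1 hη M hηK hν x hu hl hlK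
        _ = _ := by
            rw [← Real.exp_add]
            congr 1
            push_cast
            ring

/-- The ghost sequence starts at v₁ as well; each of the two squared distances is at most |S|, so
together they contribute at most 1/η. -/
theorem potential_initialDecision_le (hη : 0 < η) {ν : S × A → ℝ}
    (hν : ν ∈ stdSimplex ℝ (S × A)) {v q : S → ℝ} (hv : ∀ s, 0 ≤ v s ∧ v s ≤ 1)
    (hq : ∀ s, 0 ≤ q s ∧ q s ≤ 1) :
    potential η ν q (initialDecision v hv) v ≤
      1 / η * (1 + Real.log (Fintype.card (S × A))) := by
  have hc : (0 : ℝ) < Fintype.card S := by exact_mod_cast Fintype.card_pos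
  have hsum : ∑ s, (v s - q s) ^ 2 ≤ Fintype.card S := by
    calc ∑ s, (v s - q s) ^ 2 ≤ ∑ _s : S, (1 : ℝ) := Finset.sum_le_sum fun s _ => by
          obtain ⟨a, b⟩ := hv s
          obtain ⟨c, d⟩ := hq s
          rw [sq_le_one_iff_abs_le_one, abs_le]
          exact ⟨by linarith, by linarith⟩
      _ = Fintype.card S := by simp
  have hkl := mul_le_mul_of_nonneg_left (klSum_uniform_le hν) (one_div_pos.2 hη).le
  calc potential η ν q (initialDecision v hv) v
      ≤ 1 / (2 * (η * Fintype.card S)) * (Fintype.card S + Fintype.card S) +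
        1 / η * Real.log (Fintype.card (S × A)) := by
        unfold potential
        refine add_le_add ?_ hkl
        gcongr
        · exact hsum
    _ = _ := by
        field_simp
        ring

end Loop

/-! ### Sample complexity -/

section Rate

variable {S A : Type*} [Fintype S] [Fintype A] [Nonempty S] [Nonempty A] {γ : ℝ}

theorem normalizedRate_pos {C : ℝ} (hC : 0 < C) (k : ℕ) (h1 : γ < 1) {ε : ℝ} (hε : 0 < ε)
    (δ : ℝ) : 0 < normalizedRate C k S A γ ε δ := by
  have hpos : 0 < 1 - γ := sub_pos.2 h1
  have hS : (0 : ℝ) < Fintype.card S := by exact_mod_cast Fintype.card_pos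
  have hA : (0 : ℝ) < Fintype.card A := by exact_mod_cast Fintype.card_pos
  have hL : 0 < max 1 (Real.log (1 / δ)) := lt_max_of_lt_left one_pos
  have hlog : 0 < Real.log (2 + (Fintype.card S : ℝ) * (Fintype.card A : ℝ) / ((1 - γ) * ε)) := by
    refine Real.log_pos ?_
    have : 0 < (Fintype.card S : ℝ) * (Fintype.card A : ℝ) / ((1 - γ) * ε) := by positivity
    linarith
  unfold normalizedRate
  positivity

omit [Nonempty S] [Nonempty A] in
theorem unnormalizedRate_eq (C : ℝ) (k : ℕ) (γ ε δ : ℝ) :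
    unnormalizedRate C k S A γ ε δ = normalizedRate C k S A γ ((1 - γ) * ε) δ := by
  rw [unnormalizedRate, normalizedRate]
  ring_nf

omit [Nonempty S] [Nonempty A] in
theorem isEpsOptimalUnnormalized_iff (h1 : γ < 1) (M : MDP S A) (ε : ℝ) (π : Policy S A) :
    IsEpsOptimalUnnormalized γ M ε π ↔ IsEpsOptimal γ M ((1 - γ) * ε) π := by
  have e : ∀ π, initMean M (value γ M π) = (1 - γ) * initMean M (discountedValue γ M π) :=
    fun π => mean_const_mul M.init _ _
  refine forall_congr' fun π' => ?_
  rw [e, e, ← mul_sub, mul_le_mul_iff_right₀ (sub_pos.2 h1)]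

theorem calls_mirrorDescentRL_le (M : MDP S A) (v₁ : S → ℝ) (hv₁ : ∀ s, 0 ≤ v₁ s ∧ v₁ s ≤ 1)
    {B : ℝ} (hB : 0 ≤ B) :
    ∀ o ∈ ((mirrorDescentRL γ v₁ hv₁ ⌈B⌉₊).exec M).support, (o.2 : ℝ) ≤ 4 * B := by
  intro o ho
  rw [calls_mdLoop M _ _ _ _ o ho]
  have h := Nat.ceil_lt_add_one hB
  push_cast
  -- There are ⌈B⌉ - 1 < B rounds; the truncated subtraction needs a separate case at zero.
  rcases Nat.eq_zero_or_pos ⌈B⌉₊ with hz | hp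
  · simp [hz, hB]
  · rw [Nat.cast_sub hp]
    push_cast
    linarith

theorem le_toOuterMeasure_of_compl {α : Type*} (p : PMF α) {s t : Set α} {δ : ℝ} (hδ : 0 ≤ δ)
    (hst : ∀ x, x ∉ s → x ∈ t) (ht : p.toOuterMeasure t ≤ ENNReal.ofReal δ) :
    ENNReal.ofReal (1 - δ) ≤ p.toOuterMeasure s := by
  have huniv : p.toOuterMeasure Set.univ = 1 :=
    (PMF.toOuterMeasure_apply_eq_one_iff p _).2 (Set.subset_univ _)
  have hle : (1 : ENNReal) ≤ p.toOuterMeasure s + p.toOuterMeasure t := by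
    rw [← huniv]
    refine (p.toOuterMeasure.mono ?_).trans (MeasureTheory.measure_union_le s t)
    intro x _
    by_cases hx : x ∈ s
    · exact Or.inl hx
    · exact Or.inr (hst x hx)
  rw [ENNReal.ofReal_sub _ hδ, ENNReal.ofReal_one]
  exact tsub_le_iff_right.2 (hle.trans (by gcongr))

/-- With enough rounds, the bound on the regret is at most the admissible error. -/
theorem regret_le_of_normalizedRate_le (h0 : 0 ≤ γ) (h1 : γ < 1) {ε δ : ℝ} (hε : 0 < ε)
    (hε1 : ε < 1) {N : ℕ} (hN : normalizedRate 30000 2 S A γ ε δ ≤ N) :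
    (Fintype.card (S × A) : ℝ) * max 1 (Real.log (1 / δ)) ≤ N ∧
    1 / (1 - γ) * √((Fintype.card (S × A) : ℝ) * N) * √(max 1 (Real.log (1 / δ))) *
      (40 + Real.log (Fintype.card (S × A))) ≤ N * (ε / 2) := by
  have hpos : 0 < 1 - γ := sub_pos.2 h1
  have hKe : (Fintype.card S : ℝ) * (Fintype.card A : ℝ) = Fintype.card (S × A) := by
    rw [Fintype.card_prod]
    push_cast
    rfl
  rw [normalizedRate, hKe] at hN
  set K : ℝ := (Fintype.card (S × A) : ℝ) with hK
  set L : ℝ := max 1 (Real.log (1 / δ)) with hL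
  set ℓ : ℝ := Real.log (2 + K / ((1 - γ) * ε)) with hℓ
  have hK1 : 1 ≤ K := by
    rw [hK]
    exact_mod_cast Fintype.card_pos
  have hL1 : 1 ≤ L := le_max_left _ _
  have hd : (1 - γ) * ε ≤ 1 := mul_le_one₀ (by linarith) hε.le hε1.le
  have hd0 : 0 < (1 - γ) * ε := mul_pos hpos hε
  have hKd : K ≤ K / ((1 - γ) * ε) := by
    rw [le_div_iff₀ hd0]
    exact mul_le_of_le_one_right (by linarith) hd
  have hℓ1 : 1 / 2 ≤ ℓ := by
    have : Real.log 2 ≤ ℓ := Real.log_le_log (by norm_num) (by linarith)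
    linarith [Real.log_two_gt_d9]
  have hℓK : Real.log K ≤ ℓ := Real.log_le_log (by linarith) (by linarith)
  have hlogK : 0 ≤ Real.log K := Real.log_nonneg hK1
  have hKL : 1 ≤ K * L := one_le_mul_of_one_le_of_one_le hK1 hL1
  have hN' : 30000 * (K * L) * ℓ ^ 2 ≤ N * ((1 - γ) ^ 2 * ε ^ 2) := by
    have e : 30000 * (K * L / ((1 - γ) ^ 2 * ε ^ 2)) * ℓ ^ 2 =
        30000 * (K * L) * ℓ ^ 2 / ((1 - γ) ^ 2 * ε ^ 2) := by ring
    rw [e, div_le_iff₀ (by positivity)] at hN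
    exact hN
  have hℓ2 : 1 / 4 ≤ ℓ ^ 2 := by nlinarith
  constructor
  · have k1 : (N : ℝ) * ((1 - γ) ^ 2 * ε ^ 2) ≤ N := by
      refine mul_le_of_le_one_right (Nat.cast_nonneg _) ?_
      rw [← mul_pow]
      exact pow_le_one₀ hd0.le hd
    nlinarith
  -- Here 40 ≤ 80ℓ because ℓ ≥ 1/2. After squaring, 81² = 6561 must be at most a quarter of the
  -- constant 30000.
  · have hsum : 40 + Real.log K ≤ 81 * ℓ := by linarith
    refine (pow_le_pow_iff_left₀ (by positivity) (by positivity) two_ne_zero).1 ?_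
    rw [mul_pow, mul_pow, mul_pow, Real.sq_sqrt (by positivity), Real.sq_sqrt (by positivity)]
    have k1 := pow_le_pow_left₀ (by positivity) hsum 2
    have k2 := mul_le_mul_of_nonneg_left hN'
      (by positivity : 0 ≤ (N : ℝ) * (1 / (1 - γ)) ^ 2 / 4)
    have k3 : (N : ℝ) * (1 / (1 - γ)) ^ 2 / 4 * (N * ((1 - γ) ^ 2 * ε ^ 2)) =
        (N * (ε / 2)) ^ 2 := by
      field_simp
      ring
    calc (1 / (1 - γ)) ^ 2 * (K * N) * L * (40 + Real.log K) ^ 2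
        ≤ (1 / (1 - γ)) ^ 2 * (K * N) * L * (81 * ℓ) ^ 2 :=
          mul_le_mul_of_nonneg_left k1 (by positivity)
      _ = 6561 * ((N : ℝ) * (1 / (1 - γ)) ^ 2 * (K * L) * ℓ ^ 2) := by ring
      _ ≤ 7500 * ((N : ℝ) * (1 / (1 - γ)) ^ 2 * (K * L) * ℓ ^ 2) :=
          mul_le_mul_of_nonneg_right (by norm_num) (by positivity)
      _ = (N : ℝ) * (1 / (1 - γ)) ^ 2 / 4 * (30000 * (K * L) * ℓ ^ 2) := by ring
      _ ≤ (N * (ε / 2)) ^ 2 := k2.trans_eq k3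

theorem mirrorDescentRL_normalized (h0 : 0 ≤ γ) (h1 : γ < 1) {ε δ : ℝ} (hε : 0 < ε)
    (hδ : 0 < δ) (v₁ : S → ℝ) (hv₁ : ∀ s, 0 ≤ v₁ s ∧ v₁ s ≤ 1) (M : MDP S A)
    {N : ℕ} (hN : normalizedRate 30000 2 S A γ ε δ ≤ N) :
    ENNReal.ofReal (1 - δ) ≤
      ((mirrorDescentRL γ v₁ hv₁ N).exec M).toOuterMeasure {o | IsEpsOptimal γ M ε o.1} := by
  have hval : ∀ π, 0 ≤ initMean M (value γ M π) ∧ initMean M (value γ M π) ≤ 1 := fun π =>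
    initMean_mem_Icc M fun s => value_mem M π h0 h1 s
  -- For ε ≥ 1 every policy qualifies, since normalized values lie in [0, 1].
  rcases le_or_gt 1 ε with hε1 | hε1
  · have hempty : ∀ o : Policy S A × ℕ, o ∉ {o : Policy S A × ℕ | IsEpsOptimal γ M ε o.1} →
        o ∈ (∅ : Set (Policy S A × ℕ)) := fun o ho =>
      ho fun π' => by linarith [(hval π').2, (hval o.1).1]
    exact le_toOuterMeasure_of_compl _ hδ.le hempty (by simp)
  obtain ⟨hKL, hT⟩ := regret_le_of_normalizedRate_le h0 h1 hε hε1 hN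
  have hKe : (Fintype.card S : ℝ) * (Fintype.card A : ℝ) = Fintype.card (S × A) := by
    rw [Fintype.card_prod]
    push_cast
    rfl
  set K : ℝ := (Fintype.card (S × A) : ℝ) with hK
  set L : ℝ := max 1 (Real.log (1 / δ)) with hL
  set H : ℝ := 1 / (1 - γ) with hH
  have hpos : 0 < 1 - γ := sub_pos.2 h1
  have hHpos : 0 < H := by positivity
  have hK1 : 1 ≤ K := by
    rw [hK]
    exact_mod_cast Fintype.card_pos
  have hL1 : 1 ≤ L := le_max_left _ _
  have hKN : K ≤ N := (le_mul_of_one_le_right (by linarith) hL1).trans hKL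
  have hN1 : 1 ≤ N := by exact_mod_cast hK1.trans hKN
  have hNpos : (0 : ℝ) < N := by linarith
  set R : ℝ := √(K * N) with hR
  set Q : ℝ := √L with hQ
  have hRsq : R ^ 2 = K * N := Real.sq_sqrt (by positivity)
  have hQsq : Q ^ 2 = L := Real.sq_sqrt (by linarith)
  have hRpos : 0 < R := Real.sqrt_pos.2 (by positivity)
  have hQpos : 0 < Q := Real.sqrt_pos.2 (by linarith)
  have hKR : K ≤ R := Real.le_sqrt_of_sq_le (by nlinarith)
  have hR1 : 1 ≤ R := hK1.trans hKR
  have hQKR : Q * K ≤ R := by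
    refine (pow_le_pow_iff_left₀ (by positivity) hRpos.le two_ne_zero).1 ?_
    rw [mul_pow, hQsq, hRsq]
    nlinarith
  -- A policy within ε/2 of the supremum replaces an optimal one; the regret may then use the other
  -- Nε/2.
  obtain ⟨_, ⟨π', rfl⟩, hπ'⟩ := exists_lt_of_lt_csSup
    (Set.range_nonempty fun π : Policy S A => initMean M (value γ M π))
    (sub_lt_self _ (half_pos hε))
  obtain ⟨ν, hν, hJ⟩ := exists_occupancy M π' h0 h1
  set J := initMean M (value γ M π') with hJdef
  have hbdd : BddAbove (Set.range fun π : Policy S A => initMean M (value γ M π)) :=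
    ⟨1, by rintro _ ⟨π, rfl⟩; exact (hval π).2⟩
  set η : ℝ := (1 - γ) / √((Fintype.card S : ℝ) * (Fintype.card A : ℝ) * (N : ℝ)) with hη
  have hηe : η = 1 / (H * R) := by
    rw [hη, hKe, hR, hH]
    field_simp
  have hηpos : 0 < η := by
    rw [hηe]
    positivity
  -- The Chernoff parameter balances l · HRQ = L/10 against l²KNH² = L/100. It is admissible because
  -- KL ≤ N gives QK ≤ R.
  set l : ℝ := Q / (10 * H * R) with hl
  have htail := exec_mdLoop_tail h0 h1 hηpos M (by
      rw [← hK, ← hH, hηe]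
      rw [div_mul_eq_mul_div, div_mul_eq_mul_div, div_le_one (by positivity)]
      nlinarith) hν (hval π').2 hJ (l := l) (by positivity) (by
      rw [← hK, ← hH, hl, div_mul_eq_mul_div, div_le_one (by positivity)]
      nlinarith) N (N * (ε / 2)) (1 / η * (1 + Real.log K)) (N - 1) 0
      (initialDecision v₁ hv₁) 0 v₁ 0 (by omega)
      (fun i => by
        have : 0 < 1 / K := by positivity
        exact this) (fun i => le_rfl) hv₁ (fun q hq => by
        have := potential_initialDecision_le hηpos hν hv₁ hq
        simp only [CharP.cast_eq_zero, zero_mul, Prod.snd_zero, Pi.zero_apply,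
          Finset.sum_const_zero, sub_zero, add_zero, zero_add]
        exact sub_nonneg.2 this)
  rw [← hK, ← hH] at htail
  refine le_toOuterMeasure_of_compl _ hδ.le (fun o ho => ?_) (htail.trans
    (ENNReal.ofReal_le_ofReal ?_))
  · simp only [Set.mem_ofPred_eq, IsEpsOptimal, not_forall, not_le] at ho ⊢
    obtain ⟨π'', h''⟩ := ho
    have hsup := le_csSup hbdd ⟨π'', rfl⟩
    simp only at hsup hπ'
    exact mul_lt_mul_of_pos_left (by linarith) hNpos
  · have hSK : (Fintype.card S : ℝ) ≤ K := by
      rw [← hKe]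
      exact le_mul_of_one_le_right (Nat.cast_nonneg _) (by exact_mod_cast Fintype.card_pos)
    have hηK : N * (η * K * H ^ 2) = H * R := by
      rw [hηe]
      field_simp
      rw [hRsq]
      ring
    have hl0 : 0 ≤ l := by positivity
    have hNsub : ((N - 1 : ℕ) : ℝ) = N - 1 := by
      rw [Nat.cast_sub hN1, Nat.cast_one]
    have a0 : 1 / η = H * R := by
      rw [hηe, one_div_one_div]
    have a1 : ((N : ℝ) - 1) * (10 * η * Fintype.card S * H ^ 2) ≤ 10 * (H * R) := by
      calc ((N : ℝ) - 1) * (10 * η * Fintype.card S * H ^ 2) ≤ N * (10 * η * K * H ^ 2) := by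
            gcongr
            linarith
        _ = 10 * (N * (η * K * H ^ 2)) := by ring
        _ = 10 * (H * R) := by rw [hηK]
    have a2 : H ≤ H * R := le_mul_of_one_le_right hHpos.le hR1
    have a3 : ((N : ℝ) - 1) * (l * (2 * η * K * H ^ 2) + l ^ 2 * (144 * K * H ^ 2)) ≤
        l * (2 * (H * R)) + 144 / 100 * L := by
      calc ((N : ℝ) - 1) * (l * (2 * η * K * H ^ 2) + l ^ 2 * (144 * K * H ^ 2))
          ≤ N * (l * (2 * η * K * H ^ 2) + l ^ 2 * (144 * K * H ^ 2)) := by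
            gcongr
            linarith
        _ = l * (2 * (N * (η * K * H ^ 2))) + 144 * (l ^ 2 * H ^ 2 * (K * N)) := by ring
        _ = l * (2 * (H * R)) + 144 / 100 * L := by
            rw [hηK, ← hRsq, hl, ← hQsq]
            field_simp
            ring
    have a4 : l * (H * R * Q) = L / 10 := by
      rw [hl, ← hQsq]
      field_simp
    have hQ1 : 1 ≤ Q := Real.one_le_sqrt.2 hL1
    have hlogK : 0 ≤ Real.log K := Real.log_nonneg hK1
    -- The deterministic terms total at most HR(13 + log K), against the threshold HRQ(40 + log K).
    -- Of the remaining -25HRQ, multiplication by l makes -2.5L, which absorbs the variance term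
    -- 1.44L and leaves at most -L; the -2HR cancels the drift in `a3`.
    have a5 : 0 + 1 / η * (1 + Real.log K) +
        ((N : ℝ) - 1) * (10 * η * Fintype.card S * H ^ 2) + 2 * H - N * (ε / 2) ≤
        -(25 * (H * R * Q)) - 2 * (H * R) := by
      have b1 : H * R * (15 + Real.log K) ≤ H * R * Q * (15 + Real.log K) :=
        mul_le_mul_of_nonneg_right (le_mul_of_one_le_right (by positivity) hQ1) (by positivity)
      rw [a0]
      linarith
    have a6 := mul_le_mul_of_nonneg_left a5 hl0
    calc _ ≤ Real.exp (-L) := by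
          refine Real.exp_le_exp.2 ?_
          rw [hNsub]
          linarith
      _ ≤ Real.exp (Real.log δ) := by
          refine Real.exp_le_exp.2 ?_
          have : Real.log (1 / δ) ≤ L := le_max_right _ _
          rw [one_div, Real.log_inv] at this
          linarith
      _ = δ := Real.exp_log hδ

end Rate

end

end MirrorRL

theorem mainTheorem5 :
    ∃ C : ℝ, 0 < C ∧ ∃ k : ℕ,
      ∀ (S : Type*) (A : Type*) [Fintype S] [Fintype A] [Nonempty S] [Nonempty A]
        (γ : ℝ), 0 ≤ γ → γ < 1 → ∀ ε : ℝ, 0 < ε → ∀ δ : ℝ, 0 < δ → δ < 1 →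
      ∀ (v₁ : S → ℝ) (hv₁ : ∀ s, 0 ≤ v₁ s ∧ v₁ s ≤ 1) (M : MirrorRL.MDP S A),
        -- normalized returns: with at least the stated number of rounds the learned policy is
        -- `ε`-optimal with probability at least `1 - δ` ...
        (∀ N : ℕ, MirrorRL.normalizedRate C k S A γ ε δ ≤ N →
          ENNReal.ofReal (1 - δ) ≤
            ((MirrorRL.mirrorDescentRL γ v₁ hv₁ N).exec M).toOuterMeasure
              {o | MirrorRL.IsEpsOptimal γ M ε o.1}) ∧
        -- ... and for the least such number the calls to the generative model are bounded
        (∀ o ∈ ((MirrorRL.mirrorDescentRL γ v₁ hv₁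
              ⌈MirrorRL.normalizedRate C k S A γ ε δ⌉₊).exec M).support,
          (o.2 : ℝ) ≤ 4 * MirrorRL.normalizedRate C k S A γ ε δ) ∧
        -- the same for unnormalized returns
        (∀ N : ℕ, MirrorRL.unnormalizedRate C k S A γ ε δ ≤ N →
          ENNReal.ofReal (1 - δ) ≤
            ((MirrorRL.mirrorDescentRL γ v₁ hv₁ N).exec M).toOuterMeasure
              {o | MirrorRL.IsEpsOptimalUnnormalized γ M ε o.1}) ∧
        (∀ o ∈ ((MirrorRL.mirrorDescentRL γ v₁ hv₁
              ⌈MirrorRL.unnormalizedRate C k S A γ ε δ⌉₊).exec M).support,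
          (o.2 : ℝ) ≤ 4 * MirrorRL.unnormalizedRate C k S A γ ε δ) := by
  refine ⟨30000, by norm_num, 2, ?_⟩
  intro S A _ _ _ _ γ h0 h1 ε hε δ hδ _ v₁ hv₁ M
  have hpos : 0 < (1 - γ) * ε := mul_pos (sub_pos.2 h1) hε
  refine ⟨fun N hN => MirrorRL.mirrorDescentRL_normalized h0 h1 hε hδ v₁ hv₁ M hN,
    MirrorRL.calls_mirrorDescentRL_le M v₁ hv₁
      (MirrorRL.normalizedRate_pos (by norm_num) 2 h1 hε δ).le, ?_, ?_⟩
  · intro N hN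
    rw [MirrorRL.unnormalizedRate_eq] at hN
    simp only [MirrorRL.isEpsOptimalUnnormalized_iff h1]
    exact MirrorRL.mirrorDescentRL_normalized h0 h1 hpos hδ v₁ hv₁ M hN
  · rw [MirrorRL.unnormalizedRate_eq]
    exact MirrorRL.calls_mirrorDescentRL_le M v₁ hv₁
      (MirrorRL.normalizedRate_pos (by norm_num) 2 h1 hpos δ).le
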